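/- Let $(\gamma_n)_{n\ge 1}$ be a sequence of real numbers in $(-1/2,1/2)$ and let $\nu=\prod_{n\ge1}\nu_n$ be the product measure on $\{-1,1\}^{\{1,2,3,\dots\}}$ with marginals $\nu_n(\{1\})=\tfrac12+\gamma_n$ and $\nu_n(\{-1\})=\tfrac12-\gamma_n$. For $x=(x_j)_{j\ge1}\in\{-1,1\}^{\{1,2,3,\dots\}}$ and $k\ge1$, let $W_k$ be a uniformly distributed random word in $\{-1,1\}^k$ and let $$M_k^x=\#\{1\le j\le 2^k : x_j x_{j+1}\cdots x_{j+k-1}=W_k\}.$$ Call $x$ *simply Poisson generic* if $M_k^x$ converges in distribution to a Poisson random variable of mean one, that is, $\lim_{k\to\infty}\mathbb P(M_k^x=n)=\frac{1}{e}\cdot\frac{1}{n!}$ for every integer $n\ge0$. (1) If $\gamma_n=O\big((\log n)^{-(1/2+\delta)}\big)$ as $n\to\infty$ for some $\delta>0$, then $\nu$-almost every $x$ is simply Poisson generic. (2) If, for some $\delta>0$, $\gamma_n=(\log n)^{-(1/2-\delta)}$ for all sufficiently large $n$, then $\nu$-almost every $x$ is not simply Poisson generic. -/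

import Mathlib

open MeasureTheory ProbabilityTheory Filter Asymptotics
open scoped Nat ENNReal

noncomputable section

/-- The measure on `{-1, 1}` (realised as the units `ℤˣ` of `ℤ`) which gives mass `1/2 + c` to `1`
and mass `1/2 - c` to `-1`; it is a probability measure when `c ∈ (-1/2, 1/2)`. -/
def signMeasure (c : ℝ) : Measure ℤˣ :=
  ENNReal.ofReal (1 / 2 + c) • Measure.dirac 1 + ENNReal.ofReal (1 / 2 - c) • Measure.dirac (-1)

theorem isProbabilityMeasure_signMeasure {c : ℝ} (hc : c ∈ Set.Ioo (-(1 / 2) : ℝ) (1 / 2)) :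
    IsProbabilityMeasure (signMeasure c) := by
  obtain ⟨h1, h2⟩ := hc
  constructor
  simp only [signMeasure, Measure.add_apply, Measure.smul_apply, measure_univ, smul_eq_mul, mul_one]
  rw [← ENNReal.ofReal_add (by linarith) (by linarith)]
  norm_num

/-- The product measure on `{-1, 1}^{1, 2, 3, …}` whose `n`-th marginal gives mass `1/2 + γ n`
to `1` and mass `1/2 - γ n` to `-1`. -/
def nuMeasure (γ : ℕ+ → ℝ) : Measure (ℕ+ → ℤˣ) :=
  Measure.infinitePi fun n => signMeasure (γ n)

/-- The number of occurrences of the `k`-word `w` in `x` up to time `2 ^ k`: the number of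
positions `1 ≤ j + 1 ≤ 2 ^ k` such that `x_{j+1} … x_{j+k} = w`. -/
def occurrences (x : ℕ+ → ℤˣ) (k : ℕ) (w : Fin k → ℤˣ) : ℕ :=
  ((Finset.range (2 ^ k)).filter fun j => ∀ i : Fin k, x (Nat.succPNat (j + i)) = w i).card

/-- `x` is simply Poisson generic: when `w` is a uniformly distributed random `k`-word, the number of
occurrences of `w` in `x` up to time `2 ^ k` converges in distribution to the Poisson law of
mean one, i.e. the probability that it equals `n` tends to `e⁻¹ / n!`, for every `n`. -/
def SimplyPoissonGeneric (x : ℕ+ → ℤˣ) : Prop :=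
  ∀ n : ℕ, Tendsto
    (fun k : ℕ =>
      (uniformOn (Set.univ : Set (Fin k → ℤˣ))).real {w | occurrences x k w = n})
    atTop (nhds (Real.exp (-1) / n !))

end

/-!
A random word `w` of length `k` occurs in `x` at time `t < 2 ^ k` with probability exactly
`2 ^ (-k)` under the joint law of `w` and `x`, whatever the biases are. Hence the times before
`2 ^ (k / 2)` can be ignored, and at the later times `log n` is of the order of `k`. The threshold
`1 / 2` for the exponent comes from the mean number of occurrences given `w`,
`2 ^ (-k) * ∑ t, ∏ i, (1 + 2 * w i * γ (t + i))`: as a function of `w` it is close to `1` if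
`k * γ ^ 2` tends to zero and close to `0` if `k * γ ^ 2` tends to infinity.

*Small biases.* Fix `s` in `[0, 1]` and let `genFun s k x` be the generating function at `s` of the
number of occurrences in `x` of a random `k`-word. Changing one sign of `x` affects `k` windows and
hence at most `2 * k` words, so by the Efron–Stein inequality (`integral_sub_integral_sq_pi_le`) the
variance of `genFun s k` is of order `k ^ 2 / 2 ^ k`, which is summable. Thus `genFun s k x` almost
surely has the same limit as its mean (`ae_tendsto_genFun_sub_integral`). For the mean, fix `w` and
reveal `x` from left to right: a window is independent of those that end before it starts, so
`s ^ count` is multiplied on average by `1 - (1 - s) * p` at each step, up to an error coming from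
overlapping windows (`abs_integral_pow_countEvents_sub_exp_le`). Two overlapping windows can both
read `w` only if `w` is periodic, which makes these errors negligible on average
(`sum_nuMeasure_real_hit_inter_hit_le`). What remains is `exp (-(1 - s) * l w)`, where the
conditional mean `l w` is close to `1` by a second moment computation
(`sum_sq_sum_nuMeasure_real_hit_sub_one_le`). The generating functions at `s = 1 / (m + 1)` determine
the limits of the probabilities (`tendsto_of_tendsto_tsum_mul_pow`).

*Large biases.* All but a small proportion of words have letters that sum to at most
`R = k * a / (4 * C)`, where the biases lie between `a` and `C * a`. Each such word `w` has
probability at most `2 ^ (-k) * exp (-k * a ^ 2 / 2 + o(1))` to occur at a given time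
(`nuMeasure_real_hit_le_of_signSum_le`), since `1 + u ≤ exp (u - u ^ 2 / 4)` and the biases hardly
vary inside a window. So a random word occurs with probability tending to zero, and almost surely
the probability of zero occurrences tends to `1` along a subsequence instead of to `exp (-1)`.
-/

/-! ### Tools from probability theory -/

/-- The Efron–Stein inequality for functions with bounded differences: on a product of `N`
probability spaces, a function that varies by at most `c` in each coordinate has variance at most
`N * c ^ 2`. -/
theorem integral_sub_integral_sq_pi_le {Ω : Type*} [Fintype Ω] [MeasurableSpace Ω]
    [DiscreteMeasurableSpace Ω] {c : ℝ} :
    ∀ (N : ℕ) (μ : Fin N → Measure Ω) [∀ i, IsProbabilityMeasure (μ i)] (f : (Fin N → Ω) → ℝ),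
      (∀ x i a, |f (Function.update x i a) - f x| ≤ c) →
      ∫ x, (f x - ∫ y, f y ∂Measure.pi μ) ^ 2 ∂Measure.pi μ ≤ N * c ^ 2 := by
  intro N
  induction N with
  | zero =>
    intro μ _ f _
    have hf : ∀ x, f x = f default := fun x => by rw [Subsingleton.elim x default]
    simp [hf]
  | succ n ih =>
    intro μ _ f hf
    have hmp := (measurePreserving_piFinSuccAbove μ 0).symm
    set ν := Measure.pi fun j => μ (Fin.succAbove 0 j) with hν
    have key : ∀ G : (Fin (n + 1) → Ω) → ℝ, ∫ x, G x ∂Measure.pi μ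
        = ∫ y, ∫ a, G (Fin.cons a y) ∂μ 0 ∂ν := by
      intro G
      rw [← hmp.integral_comp' (g := G), integral_prod_symm _ Integrable.of_finite]
      have hcons : ∀ a y, (MeasurableEquiv.piFinSuccAbove (fun _ => Ω) 0).symm (a, y)
          = (Fin.cons a y : Fin (n + 1) → Ω) := fun a y => Fin.insertNth_zero' a y
      simp only [hcons]
    have hbd : ∀ g : Ω → ℝ, (∀ b, |g b| ≤ c) → |∫ b, g b ∂μ 0| ≤ c := fun g hg => by
      have := norm_integral_le_of_norm_le_const (μ := μ 0) (f := g) (C := c) (.of_forall hg)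
      rwa [probReal_univ, mul_one] at this
    rw [key, key f]
    set F : (Fin n → Ω) → ℝ := fun y => ∫ a, f (Fin.cons a y) ∂μ 0 with hF
    set m := ∫ y, F y ∂ν with hm
    have hFd : ∀ x i a, |F (Function.update x i a) - F x| ≤ c := by
      intro x i a
      simp only [hF]
      rw [← integral_sub Integrable.of_finite Integrable.of_finite]
      refine hbd _ fun b => ?_
      have := hf (Fin.cons b x) i.succ a
      rwa [← Fin.cons_update] at this
    have hc : ∀ a y, |f (Fin.cons a y) - F y| ≤ c := by
      intro a y
      have h1 : f (Fin.cons a y) - F y = ∫ b, (f (Fin.cons a y) - f (Fin.cons b y)) ∂μ 0 := by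
        rw [integral_sub Integrable.of_finite Integrable.of_finite]
        simp [hF]
      rw [h1]
      refine hbd _ fun b => ?_
      have := hf (Fin.cons b y) 0 a
      rwa [Fin.update_cons_zero] at this
    -- The variance splits into the conditional variance and the variance of the conditional mean.
    have hinner : ∀ y, ∫ a, (f (Fin.cons a y) - m) ^ 2 ∂μ 0 ≤ c ^ 2 + (F y - m) ^ 2 := by
      intro y
      have h1 : ∀ a, (f (Fin.cons a y) - m) ^ 2 = (f (Fin.cons a y) - F y) ^ 2
          + ((2 * (F y - m)) * (f (Fin.cons a y) - F y) + (F y - m) ^ 2) := fun a => by ring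
      simp only [h1]
      rw [integral_add Integrable.of_finite Integrable.of_finite,
        integral_add Integrable.of_finite Integrable.of_finite, integral_const_mul,
        integral_sub Integrable.of_finite Integrable.of_finite]
      have h2 : ∫ a, (f (Fin.cons a y) - F y) ^ 2 ∂μ 0 ≤ ∫ _, c ^ 2 ∂μ 0 := by
        refine integral_mono Integrable.of_finite Integrable.of_finite fun a => ?_
        exact sq_le_sq' (by linarith [(abs_le.1 (hc a y)).1]) (abs_le.1 (hc a y)).2
      have h3 : ∫ a, f (Fin.cons a y) ∂μ 0 = F y := rfl
      simp only [h3, integral_const, probReal_univ, one_smul] at h2 ⊢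
      linarith
    calc ∫ y, ∫ a, (f (Fin.cons a y) - m) ^ 2 ∂μ 0 ∂ν
        ≤ ∫ y, (c ^ 2 + (F y - m) ^ 2) ∂ν :=
          integral_mono Integrable.of_finite Integrable.of_finite hinner
      _ = c ^ 2 + ∫ y, (F y - m) ^ 2 ∂ν := by
          rw [integral_add Integrable.of_finite Integrable.of_finite]; simp
      _ ≤ c ^ 2 + n * c ^ 2 := by
          have := ih (fun j => μ (Fin.succAbove 0 j)) F hFd
          simp only [hm]
          gcongr
      _ = ((n + 1 : ℕ) : ℝ) * c ^ 2 := by push_cast; ring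

/-- Random variables whose second moments are summable tend to zero almost surely. -/
theorem ae_tendsto_zero_of_summable_integral_sq {Ω : Type*} [MeasurableSpace Ω] {μ : Measure Ω}
    {Y : ℕ → Ω → ℝ} (hY : ∀ k, Measurable (Y k)) (hint : ∀ k, Integrable (fun x => Y k x ^ 2) μ)
    (hs : Summable fun k => ∫ x, Y k x ^ 2 ∂μ) :
    ∀ᵐ x ∂μ, Tendsto (fun k => Y k x) atTop (nhds 0) := by
  have h1 : ∫⁻ x, ∑' k, ENNReal.ofReal (Y k x ^ 2) ∂μ ≠ ∞ := by
    rw [lintegral_tsum fun k => ((hY k).pow_const 2).ennreal_ofReal.aemeasurable]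
    have : ∀ k, ∫⁻ x, ENNReal.ofReal (Y k x ^ 2) ∂μ = ENNReal.ofReal (∫ x, Y k x ^ 2 ∂μ) :=
      fun k => (ofReal_integral_eq_lintegral_ofReal (hint k)
        (.of_forall fun x => sq_nonneg _)).symm
    simp only [this]
    rw [← ENNReal.ofReal_tsum_of_nonneg (fun k => integral_nonneg fun x => sq_nonneg _) hs]
    exact ENNReal.ofReal_ne_top
  have h2 := ae_lt_top (.tsum fun k => ((hY k).pow_const 2).ennreal_ofReal) h1
  filter_upwards [h2] with x hx
  have h3 := ENNReal.tendsto_cofinite_zero_of_tsum_ne_top hx.ne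
  rw [Nat.cofinite_eq_atTop] at h3
  have h4 := (ENNReal.tendsto_toReal ENNReal.zero_ne_top).comp h3
  have h5 : Tendsto (fun k => Y k x ^ 2) atTop (nhds 0) := by
    refine h4.congr fun k => ?_
    simp [ENNReal.toReal_ofReal (sq_nonneg _)]
  have h6 := h5.sqrt
  simp only [Real.sqrt_sq_eq_abs, Real.sqrt_zero] at h6
  exact (tendsto_zero_iff_abs_tendsto_zero _).2 h6

/-- The number of events among `A 0, …, A (n - 1)` that occur. -/
noncomputable def countEvents {Ω : Type*} (A : ℕ → Set Ω) (n : ℕ) (x : Ω) : ℕ :=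
  open Classical in ((Finset.range n).filter fun t => x ∈ A t).card

theorem countEvents_succ {Ω : Type*} (A : ℕ → Set Ω) (n : ℕ) (x : Ω) :
    countEvents A (n + 1) x = countEvents A n x + (A n).indicator (fun _ => 1) x := by
  classical
  rw [countEvents, countEvents, Finset.range_add_one, Finset.filter_insert]
  by_cases h : x ∈ A n <;> simp [h]

theorem measurable_countEvents {Ω : Type*} [MeasurableSpace Ω] {A : ℕ → Set Ω}
    (hA : ∀ t, MeasurableSet (A t)) (n : ℕ) : Measurable (countEvents A n) := by
  induction n with
  | zero =>
    have : countEvents A 0 = fun _ => 0 := funext fun x => by simp [countEvents]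
    rw [this]
    exact measurable_const
  | succ n ih =>
    have : countEvents A (n + 1) = fun x => countEvents A n x + (A n).indicator (fun _ => 1) x :=
      funext (countEvents_succ A n)
    rw [this]
    exact ih.add (measurable_const.indicator (hA n))

theorem countEvents_eq_add_sum {Ω : Type*} (A : ℕ → Set Ω) {m n : ℕ} (h : m ≤ n) (x : Ω) :
    (countEvents A n x : ℝ)
      = countEvents A m x + ∑ t ∈ Finset.Ico m n, (A t).indicator (fun _ => (1 : ℝ)) x := by
  classical
  induction n, h using Nat.le_induction with
  | base => simp
  | succ n hmn ih =>
    rw [Finset.sum_Ico_succ_top hmn, countEvents_succ]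
    push_cast
    rw [ih, add_assoc]
    congr 2
    by_cases hx : x ∈ A n <;> simp [hx]

theorem abs_pow_sub_pow_add_le {s : ℝ} (h0 : 0 ≤ s) (h1 : s ≤ 1) (m d : ℕ) :
    |s ^ m - s ^ (m + d)| ≤ d := by
  have hm1 : s ^ m ≤ 1 := pow_le_one₀ h0 h1
  have hd0 : 0 ≤ s ^ d := pow_nonneg h0 d
  have hd1 : s ^ d ≤ 1 := pow_le_one₀ h0 h1
  rcases Nat.eq_zero_or_pos d with rfl | hd
  · simp
  · have : (1 : ℝ) ≤ d := by exact_mod_cast hd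
    have h2 : s ^ m - s ^ (m + d) = s ^ m * (1 - s ^ d) := by ring
    rw [h2, abs_of_nonneg (mul_nonneg (pow_nonneg h0 m) (by linarith))]
    nlinarith [pow_nonneg h0 m]

theorem abs_pow_countEvents_sub_le {Ω : Type*} (A : ℕ → Set Ω) {s : ℝ} (h0 : 0 ≤ s) (h1 : s ≤ 1)
    {m n : ℕ} (h : m ≤ n) (x : Ω) :
    |s ^ countEvents A m x - s ^ countEvents A n x|
      ≤ ∑ t ∈ Finset.Ico m n, (A t).indicator (fun _ => (1 : ℝ)) x := by
  have h2 := countEvents_eq_add_sum A h x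
  have hle : countEvents A m x ≤ countEvents A n x := by
    classical
    exact Finset.card_le_card (Finset.filter_subset_filter _ (Finset.range_mono h))
  obtain ⟨d, hd⟩ := Nat.exists_eq_add_of_le hle
  rw [hd] at h2 ⊢
  push_cast at h2
  have := abs_pow_sub_pow_add_le h0 h1 (countEvents A m x) d
  linarith

/-- Poisson approximation for locally dependent events: if each `A t` is independent of the number
of occurrences among the `A u` with `u + k ≤ t`, then the probability generating function of the
number of occurrences is close to that of the Poisson law with the same mean. -/
theorem abs_integral_pow_countEvents_sub_exp_le {Ω : Type*} [MeasurableSpace Ω] {μ : Measure Ω}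
    [IsProbabilityMeasure μ] {A : ℕ → Set Ω} (hA : ∀ t, MeasurableSet (A t)) {s : ℝ}
    (h0 : 0 ≤ s) (h1 : s ≤ 1) {k : ℕ}
    (hk : 1 ≤ k)
    (hind : ∀ t, ∫ x, s ^ countEvents A (t + 1 - k) x * (A t).indicator (fun _ => (1 : ℝ)) x ∂μ
      = (∫ x, s ^ countEvents A (t + 1 - k) x ∂μ) * μ.real (A t)) (n : ℕ) :
    |∫ x, s ^ countEvents A n x ∂μ - Real.exp (-((1 - s) * ∑ t ∈ Finset.range n, μ.real (A t)))|
      ≤ ∑ t ∈ Finset.range n, (μ.real (A t) ^ 2 + ∑ u ∈ Finset.Ico (t + 1 - k) t,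
          (μ.real (A u ∩ A t) + μ.real (A u) * μ.real (A t))) := by
  have hpow : ∀ m, Integrable (fun x => s ^ countEvents A m x) μ := by
    intro m
    refine Integrable.of_bound (C := 1) ?_ (.of_forall fun x => ?_)
    · exact ((measurable_from_nat (f := fun j : ℕ => s ^ j)).comp
        (measurable_countEvents hA m)).aestronglyMeasurable
    · rw [Real.norm_of_nonneg (pow_nonneg h0 _)]; exact pow_le_one₀ h0 h1
  have hi : ∀ t, Integrable ((A t).indicator (fun _ => (1 : ℝ))) μ :=
    fun t => (integrable_const 1).indicator (hA t)
  have hmul : ∀ m t, Integrable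
      (fun x => s ^ countEvents A m x * (A t).indicator (fun _ => (1 : ℝ)) x) μ := by
    intro m t
    have : (fun x => s ^ countEvents A m x * (A t).indicator (fun _ => (1 : ℝ)) x)
        = (A t).indicator (fun x => s ^ countEvents A m x) := by
      ext x; by_cases hx : x ∈ A t <;> simp [hx]
    rw [this]
    exact (hpow m).indicator (hA t)
  have hii : ∀ t, ∫ x, (A t).indicator (fun _ => (1 : ℝ)) x ∂μ = μ.real (A t) := fun t => by
    rw [integral_indicator_const _ (hA t)]; simp
  induction n with
  | zero => simp [countEvents]
  | succ n ih =>
    set p := μ.real (A n) with hp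
    set n' := n + 1 - k with hn'
    have hn'n : n' ≤ n := by omega
    have hp0 : 0 ≤ p := measureReal_nonneg
    have hp1 : p ≤ 1 := measureReal_le_one
    set h := ∫ x, s ^ countEvents A n x ∂μ with hh
    set h' := ∫ x, s ^ countEvents A n' x ∂μ with hh'
    set e := Real.exp (-((1 - s) * ∑ t ∈ Finset.range n, μ.real (A t))) with he
    set J := ∫ x, s ^ countEvents A n x * (A n).indicator (fun _ => (1 : ℝ)) x ∂μ with hJ
    have hstep : ∫ x, s ^ countEvents A (n + 1) x ∂μ = h - (1 - s) * J := by
      rw [hJ, ← integral_const_mul, hh, ← integral_sub (hpow n) ((hmul n n).const_mul _)]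
      congr 1
      ext x
      rw [countEvents_succ]
      by_cases hx : x ∈ A n
      · simp [hx, pow_succ]; ring
      · simp [hx]
    have hJ1 : |J - h' * p| ≤ ∑ u ∈ Finset.Ico n' n, μ.real (A u ∩ A n) := by
      rw [hp, hh', ← hind n, hJ, ← integral_sub (hmul n n) (hmul n' n)]
      refine (abs_integral_le_integral_abs).trans ?_
      have hr : ∑ u ∈ Finset.Ico n' n, μ.real (A u ∩ A n)
          = ∫ x, ∑ u ∈ Finset.Ico n' n, (A u ∩ A n).indicator (fun _ => (1 : ℝ)) x ∂μ := by
        rw [integral_finsetSum]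
        · refine Finset.sum_congr rfl fun u _ => ?_
          rw [integral_indicator_const _ ((hA u).inter (hA n))]; simp
        · exact fun u _ => (integrable_const 1).indicator ((hA u).inter (hA n))
      rw [hr]
      refine integral_mono ((hmul n n).sub (hmul n' n)).abs ?_ fun x => ?_
      · exact integrable_finsetSum _
          fun u _ => (integrable_const 1).indicator ((hA u).inter (hA n))
      · simp only
        by_cases hx : x ∈ A n
        · have := abs_pow_countEvents_sub_le A h0 h1 hn'n x
          rw [abs_sub_comm] at this
          have hu : ∀ u, (A u ∩ A n).indicator (fun _ => (1 : ℝ)) x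
              = (A u).indicator (fun _ => (1 : ℝ)) x := fun u => by
            by_cases hxu : x ∈ A u <;> simp [hx, hxu]
          simpa only [hu, Set.indicator_of_mem hx, mul_one] using this
        · simp [hx, Set.indicator]
    have hh1 : |h' - h| ≤ ∑ u ∈ Finset.Ico n' n, μ.real (A u) := by
      rw [hh', hh, ← integral_sub (hpow n') (hpow n)]
      refine (abs_integral_le_integral_abs).trans ?_
      have hr : ∑ u ∈ Finset.Ico n' n, μ.real (A u)
          = ∫ x, ∑ u ∈ Finset.Ico n' n, (A u).indicator (fun _ => (1 : ℝ)) x ∂μ := by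
        rw [integral_finsetSum _ fun u _ => hi u]
        exact Finset.sum_congr rfl fun u _ => (hii u).symm
      rw [hr]
      exact integral_mono ((hpow n').sub (hpow n)).abs (integrable_finsetSum _ fun u _ => hi u)
        fun x => abs_pow_countEvents_sub_le A h0 h1 hn'n x
    have hexp : |Real.exp (-((1 - s) * p)) - (1 - (1 - s) * p)| ≤ p ^ 2 := by
      set y := (1 - s) * p with hy
      have hy0 : 0 ≤ y := mul_nonneg (by linarith) hp0
      have hyp : y ≤ p := by nlinarith
      have := Real.abs_exp_sub_one_sub_id_le (x := -y) (by rw [abs_neg, abs_of_nonneg hy0]; linarith)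
      have e1 : Real.exp (-y) - (1 - y) = Real.exp (-y) - 1 - -y := by ring
      rw [e1]
      nlinarith
    have he0 : 0 ≤ e := (Real.exp_pos _).le
    have he1 : e ≤ 1 := by
      rw [he, Real.exp_le_one_iff]
      have : 0 ≤ ∑ t ∈ Finset.range n, μ.real (A t) := Finset.sum_nonneg fun _ _ => measureReal_nonneg
      nlinarith
    have hes : Real.exp (-((1 - s) * ∑ t ∈ Finset.range (n + 1), μ.real (A t)))
        = e * Real.exp (-((1 - s) * p)) := by
      rw [he, ← Real.exp_add, Finset.sum_range_succ]; congr 1; ring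
    rw [hes, hstep, Finset.sum_range_succ,
      Finset.sum_add_distrib (s := Finset.Ico (n + 1 - k) n), ← Finset.sum_mul]
    set a := ∑ u ∈ Finset.Ico n' n, μ.real (A u ∩ A n)
    set b := ∑ u ∈ Finset.Ico n' n, μ.real (A u)
    set q := Real.exp (-((1 - s) * p))
    -- Up to the errors `a` and `b * p`, the event `A n` multiplies `h` by `1 - (1 - s) * p`.
    have hdec : h - (1 - s) * J - e * q = (h - e) * (1 - (1 - s) * p)
        - e * (q - (1 - (1 - s) * p)) - (1 - s) * ((J - h' * p) + (h' - h) * p) := by ring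
    rw [hdec]
    have hy1 : 0 ≤ 1 - (1 - s) * p := by nlinarith
    have hy2 : 1 - (1 - s) * p ≤ 1 := by nlinarith
    have t1 : |(h - e) * (1 - (1 - s) * p)| ≤ |h - e| := by
      rw [abs_mul, abs_of_nonneg hy1]; exact mul_le_of_le_one_right (abs_nonneg _) hy2
    have t2 : |e * (q - (1 - (1 - s) * p))| ≤ p ^ 2 := by
      rw [abs_mul, abs_of_nonneg he0]
      exact (mul_le_of_le_one_left (abs_nonneg _) he1).trans hexp
    have t3 : |(1 - s) * ((J - h' * p) + (h' - h) * p)| ≤ a + b * p := by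
      rw [abs_mul, abs_of_nonneg (by linarith : 0 ≤ 1 - s)]
      refine (mul_le_of_le_one_left (abs_nonneg _) (by linarith)).trans ?_
      refine (abs_add_le _ _).trans (add_le_add hJ1 ?_)
      rw [abs_mul, abs_of_nonneg hp0]
      exact mul_le_mul_of_nonneg_right hh1 hp0
    have t4 := abs_sub ((h - e) * (1 - (1 - s) * p) - e * (q - (1 - (1 - s) * p)))
      ((1 - s) * ((J - h' * p) + (h' - h) * p))
    have t5 := abs_sub ((h - e) * (1 - (1 - s) * p)) (e * (q - (1 - (1 - s) * p)))
    linarith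

/-- Convergence of probability generating functions at the points `1 / (m + 1)` implies convergence
of the probabilities; the laws are encoded as nonnegative sequences with sum one. -/
theorem tendsto_of_tendsto_tsum_mul_pow {p : ℕ → ℕ → ℝ} {q : ℕ → ℝ} (hp0 : ∀ k n, 0 ≤ p k n)
    (hp : ∀ k, HasSum (p k) 1) (hq0 : ∀ n, 0 ≤ q n) (hq : HasSum q 1)
    (h : ∀ m : ℕ, Tendsto (fun k => ∑' n, p k n * (1 / ((m : ℝ) + 1)) ^ n) atTop
      (nhds (∑' n, q n * (1 / ((m : ℝ) + 1)) ^ n))) (n : ℕ) :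
    Tendsto (fun k => p k n) atTop (nhds (q n)) := by
  induction n using Nat.strong_induction_on with
  | _ n ih =>
  rw [Metric.tendsto_nhds]
  intro ε hε
  obtain ⟨m, hm⟩ := exists_nat_one_div_lt (show 0 < ε / 4 by positivity)
  set s : ℝ := 1 / ((m : ℝ) + 1) with hs
  have hs0 : 0 < s := by positivity
  have hs1 : s ≤ 1 := by
    rw [hs, div_le_one (by positivity)]; linarith [(Nat.cast_nonneg m : (0 : ℝ) ≤ m)]
  have hsum : ∀ f : ℕ → ℝ, (∀ n, 0 ≤ f n) → HasSum f 1 → Summable fun i => f i * s ^ i :=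
    fun f h0 hf => Summable.of_nonneg_of_le (fun i => mul_nonneg (h0 i) (by positivity))
      (fun i => mul_le_of_le_one_right (h0 i) (pow_le_one₀ hs0.le hs1)) hf.summable
  have hmain : Tendsto (fun k => |(∑' i, p k i * s ^ i) - ∑' i, q i * s ^ i|
      + ∑ i ∈ Finset.range n, |p k i - q i| * s ^ i) atTop (nhds 0) := by
    have h1 : Tendsto (fun k => |(∑' i, p k i * s ^ i) - ∑' i, q i * s ^ i|) atTop (nhds 0) := by
      have := ((h m).sub_const (∑' i, q i * s ^ i)).abs
      rwa [sub_self, abs_zero] at this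
    have h2 : Tendsto (fun k => ∑ i ∈ Finset.range n, |p k i - q i| * s ^ i) atTop (nhds 0) := by
      have : Tendsto (fun k => ∑ i ∈ Finset.range n, |p k i - q i| * s ^ i) atTop
          (nhds (∑ i ∈ Finset.range n, 0)) := by
        refine tendsto_finsetSum _ fun i hi => ?_
        have := (((ih i (Finset.mem_range.1 hi)).sub_const (q i)).abs).mul_const (s ^ i)
        simpa using this
      simpa using this
    simpa using h1.add h2
  have hev := (hmain.eventually (gt_mem_nhds (show 0 < ε / 2 * s ^ n by positivity)))
  filter_upwards [hev] with k hk
  rw [Real.dist_eq]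
  set D : ℕ → ℝ := fun i => (p k i - q i) * s ^ i with hD
  have hDs : Summable D := by
    simpa [hD, sub_mul] using (hsum _ (hp0 k) (hp k)).sub (hsum _ hq0 hq)
  have hDt : ∑' i, D i = (∑' i, p k i * s ^ i) - ∑' i, q i * s ^ i := by
    rw [← (hsum _ (hp0 k) (hp k)).tsum_sub (hsum _ hq0 hq)]
    simp [hD, sub_mul]
  have hsplit := hDs.sum_add_tsum_nat_add (n + 1)
  rw [Finset.sum_range_succ] at hsplit
  -- The terms of index above `n` are smaller than `s ^ n` by the factor `2 * s`.
  have htail : |∑' i, D (i + (n + 1))| ≤ 2 * s ^ (n + 1) := by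
    have hb : ∀ i, |D (i + (n + 1))| ≤ (p k (i + (n + 1)) + q (i + (n + 1))) * s ^ (n + 1) := by
      intro i
      simp only [hD]
      rw [abs_mul, abs_of_nonneg (pow_nonneg hs0.le _)]
      have a1 : |p k (i + (n + 1)) - q (i + (n + 1))| ≤ p k (i + (n + 1)) + q (i + (n + 1)) := by
        rw [abs_le]
        constructor <;> linarith [hp0 k (i + (n + 1)), hq0 (i + (n + 1))]
      exact mul_le_mul a1 (pow_le_pow_of_le_one hs0.le hs1 (by omega)) (pow_nonneg hs0.le _)
        (add_nonneg (hp0 _ _) (hq0 _))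
    have hpt : ∀ f : ℕ → ℝ, (∀ n, 0 ≤ f n) → HasSum f 1 → Summable (fun i => f (i + (n + 1)))
        ∧ ∑' i, f (i + (n + 1)) ≤ 1 := by
      intro f h0 hf
      refine ⟨(summable_nat_add_iff (n + 1)).2 hf.summable, ?_⟩
      have := hf.summable.sum_add_tsum_nat_add (n + 1)
      rw [hf.tsum_eq] at this
      linarith [Finset.sum_nonneg fun i (_ : i ∈ Finset.range (n + 1)) => h0 i]
    obtain ⟨s1, b1⟩ := hpt _ (hp0 k) (hp k)
    obtain ⟨s2, b2⟩ := hpt _ hq0 hq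
    have hsm := (s1.add s2).mul_right (s ^ (n + 1))
    have habs : Summable fun i => |D (i + (n + 1))| :=
      Summable.of_nonneg_of_le (fun _ => abs_nonneg _) hb hsm
    calc |∑' i, D (i + (n + 1))| ≤ ∑' i, |D (i + (n + 1))| := by
          simpa using norm_tsum_le_tsum_norm (f := fun i => D (i + (n + 1))) habs
      _ ≤ ∑' i, (p k (i + (n + 1)) + q (i + (n + 1))) * s ^ (n + 1) := habs.tsum_le_tsum hb hsm
      _ = (∑' i, p k (i + (n + 1)) + ∑' i, q (i + (n + 1))) * s ^ (n + 1) := by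
          rw [tsum_mul_right, s1.tsum_add s2]
      _ ≤ 2 * s ^ (n + 1) := by gcongr; linarith
  have hhead : |∑ i ∈ Finset.range n, D i| ≤ ∑ i ∈ Finset.range n, |p k i - q i| * s ^ i := by
    refine (Finset.abs_sum_le_sum_abs _ _).trans (Finset.sum_le_sum fun i _ => ?_)
    simp only [hD]
    rw [abs_mul, abs_of_nonneg (pow_nonneg hs0.le _)]
  have hDn : |p k n - q n| * s ^ n = |D n| := by
    simp only [hD]
    rw [abs_mul, abs_of_nonneg (pow_nonneg hs0.le n)]
  have hDn' : |D n| < ε * s ^ n := by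
    have e1 : D n = (∑' i, D i) - ∑ i ∈ Finset.range n, D i - ∑' i, D (i + (n + 1)) := by linarith
    have e2 : 2 * s ^ (n + 1) ≤ ε / 2 * s ^ n := by
      rw [pow_succ]
      nlinarith [pow_pos hs0 n]
    rw [e1, hDt]
    have a1 := abs_sub ((∑' i, p k i * s ^ i) - ∑' i, q i * s ^ i - ∑ i ∈ Finset.range n, D i)
      (∑' i, D (i + (n + 1)))
    have a2 := abs_sub ((∑' i, p k i * s ^ i) - ∑' i, q i * s ^ i) (∑ i ∈ Finset.range n, D i)
    linarith
  rw [← hDn] at hDn'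
  exact lt_of_mul_lt_mul_right hDn' (pow_nonneg hs0.le n)

/-! ### Occurrences of a word under the product measure -/

/-- The measurable space on `ℤˣ` is the one induced by the inclusion in `ℤ`. -/
instance instDiscreteMeasurableSpaceIntUnits : DiscreteMeasurableSpace ℤˣ :=
  ⟨fun s => ⟨(fun u : ℤˣ => (u : ℤ)) '' s, trivial, Set.preimage_image_eq _ Units.val_injective⟩⟩

/-- The mass that the marginal at time `t`, that is at the coordinate `t + 1`, gives to the sign `u`. -/
noncomputable def signMass (γ : ℕ+ → ℝ) (t : ℕ) (u : ℤˣ) : ℝ := 1 / 2 + ((u : ℤ) : ℝ) * γ (Nat.succPNat t)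

/-- The event that the word `w` occurs in `x` at position `t + 1`; the time `t` counts from `0`. -/
noncomputable def hit {k : ℕ} (w : Fin k → ℤˣ) (t : ℕ) : Set (ℕ+ → ℤˣ) :=
  {x | ∀ i : Fin k, x (Nat.succPNat (t + i)) = w i}

theorem occurrences_eq_countEvents (x : ℕ+ → ℤˣ) (k : ℕ) (w : Fin k → ℤˣ) :
    occurrences x k w = countEvents (hit w) (2 ^ k) x := by
  classical
  rw [occurrences, countEvents]
  congr 1
  ext t
  rw [Finset.mem_filter, Finset.mem_filter]
  rfl

theorem measurableSet_hit {k : ℕ} (w : Fin k → ℤˣ) (t : ℕ) : MeasurableSet (hit w t) := by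
  have : hit w t = ⋂ i : Fin k, (fun x : ℕ+ → ℤˣ => x (Nat.succPNat (t + i))) ⁻¹' {w i} := by
    ext x; simp [hit]
  rw [this]
  exact .iInter fun i => measurable_pi_apply _ (.singleton _)

theorem sum_units {f : ℤˣ → ℝ} : ∑ u, f u = f 1 + f (-1) := by
  have : (Finset.univ : Finset ℤˣ) = {1, -1} := by decide
  rw [this, Finset.sum_pair (by decide)]

theorem signMeasure_real_singleton {c : ℝ} (hc : c ∈ Set.Ioo (-(1 / 2) : ℝ) (1 / 2)) (u : ℤˣ) :
    (signMeasure c).real {u} = 1 / 2 + ((u : ℤ) : ℝ) * c := by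
  obtain ⟨h1, h2⟩ := hc
  rw [measureReal_def, signMeasure]
  simp only [Measure.add_apply, Measure.smul_apply, smul_eq_mul,
    Measure.dirac_apply' _ (MeasurableSet.singleton u)]
  rcases Int.units_eq_one_or u with rfl | rfl
  · simp [Set.indicator, show (-1 : ℤˣ) ≠ 1 by decide]
    linarith
  · simp [Set.indicator, show (1 : ℤˣ) ≠ -1 by decide]
    rw [ENNReal.toReal_ofReal (by linarith)]
    ring

theorem isProbabilityMeasure_nuMeasure {γ : ℕ+ → ℝ}
    (hγ : ∀ n, γ n ∈ Set.Ioo (-(1 / 2) : ℝ) (1 / 2)) : IsProbabilityMeasure (nuMeasure γ) := by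
  have := fun n => isProbabilityMeasure_signMeasure (hγ n)
  unfold nuMeasure
  infer_instance

theorem signMass_nonneg {γ : ℕ+ → ℝ}
    (hγ : ∀ n, γ n ∈ Set.Ioo (-(1 / 2) : ℝ) (1 / 2)) (t : ℕ) (u : ℤˣ) : 0 ≤ signMass γ t u := by
  obtain ⟨h1, h2⟩ := hγ (Nat.succPNat t)
  rcases Int.units_eq_one_or u with rfl | rfl <;> simp [signMass] <;> linarith

theorem nuMeasure_real_hit {γ : ℕ+ → ℝ}
    (hγ : ∀ n, γ n ∈ Set.Ioo (-(1 / 2) : ℝ) (1 / 2)) {k : ℕ} (w : Fin k → ℤˣ) (t : ℕ) :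
    (nuMeasure γ).real (hit w t) = ∏ i : Fin k, signMass γ (t + i) (w i) := by
  have := fun n => isProbabilityMeasure_signMeasure (hγ n)
  have hinj : Function.Injective fun i : Fin k => Nat.succPNat (t + i) := fun i j h => by
    have := Nat.succPNat_injective h
    ext; omega
  obtain ⟨e, he⟩ : ∃ e : Fin k ↪ ℕ+, ∀ i, e i = Nat.succPNat (t + i) := ⟨⟨_, hinj⟩, fun _ => rfl⟩
  have hset : hit w t = ((Finset.univ.map e : Finset ℕ+) : Set ℕ+).pi
      fun n => {u | ∀ i, e i = n → u = w i} := by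
    ext x
    simp only [hit, Set.mem_pi, Finset.coe_map, Finset.coe_univ, Set.image_univ, Set.mem_range,
      forall_exists_index, forall_apply_eq_imp_iff, EmbeddingLike.apply_eq_iff_eq]
    constructor
    · intro h i j hj
      rw [hj, he]
      exact h i
    · intro h i
      rw [← he]
      exact h i i rfl
  rw [measureReal_def, nuMeasure, hset, Measure.infinitePi_pi _ fun n _ => .of_discrete,
    Finset.prod_map, ENNReal.toReal_prod]
  refine Finset.prod_congr rfl fun i _ => ?_
  have hi : {u : ℤˣ | ∀ j, e j = e i → u = w j} = {w i} := by
    ext u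
    simp
  rw [hi, he]
  exact signMeasure_real_singleton (hγ _) _

theorem iIndepFun_eval_succPNat {γ : ℕ+ → ℝ}
    (hγ : ∀ n, γ n ∈ Set.Ioo (-(1 / 2) : ℝ) (1 / 2)) :
    iIndepFun (fun (t : ℕ) (x : ℕ+ → ℤˣ) => x (Nat.succPNat t)) (nuMeasure γ) := by
  have := fun n => isProbabilityMeasure_signMeasure (hγ n)
  exact (iIndepFun_infinitePi (P := fun n => signMeasure (γ n)) (X := fun _ u => u)
    fun _ => measurable_id).precomp Nat.succPNat_injective

/-- The letters of a uniformly distributed word are independent. -/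
theorem sum_words_prod {k : ℕ} (f : Fin k → ℤˣ → ℝ) :
    ∑ w : Fin k → ℤˣ, ∏ i, f i (w i) = ∏ i, ∑ u, f i u := by
  rw [Finset.prod_univ_sum, Fintype.piFinset_univ]

theorem sum_nuMeasure_real_hit {γ : ℕ+ → ℝ}
    (hγ : ∀ n, γ n ∈ Set.Ioo (-(1 / 2) : ℝ) (1 / 2)) (k t : ℕ) :
    ∑ w : Fin k → ℤˣ, (nuMeasure γ).real (hit w t) = 1 := by
  simp only [nuMeasure_real_hit hγ]
  rw [sum_words_prod fun (i : Fin k) u => signMass γ (t + i) u]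
  refine Finset.prod_eq_one fun i _ => ?_
  rw [sum_units]; simp [signMass]; ring

theorem sum_nuMeasure_real_hit_mul_hit {γ : ℕ+ → ℝ}
    (hγ : ∀ n, γ n ∈ Set.Ioo (-(1 / 2) : ℝ) (1 / 2)) (k t t' : ℕ) :
    ∑ w : Fin k → ℤˣ, (nuMeasure γ).real (hit w t) * (nuMeasure γ).real (hit w t')
      = ∏ i : Fin k, (1 / 2 + 2 * γ (Nat.succPNat (t + i)) * γ (Nat.succPNat (t' + i))) := by
  simp only [nuMeasure_real_hit hγ, ← Finset.prod_mul_distrib]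
  rw [sum_words_prod fun (i : Fin k) u => signMass γ (t + i) u * signMass γ (t' + i) u]
  refine Finset.prod_congr rfl fun i _ => ?_
  rw [sum_units]; simp [signMass]; ring

theorem nuMeasure_real_hit_le {γ : ℕ+ → ℝ}
    (hγ : ∀ n, γ n ∈ Set.Ioo (-(1 / 2) : ℝ) (1 / 2)) {k : ℕ} (w : Fin k → ℤˣ) {t : ℕ} {g : ℝ}
    (hg : ∀ i : ℕ, |γ (Nat.succPNat (t + i))| ≤ g) :
    (nuMeasure γ).real (hit w t) ≤ (1 / 2 + g) ^ k := by
  rw [nuMeasure_real_hit hγ]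
  refine (Finset.prod_le_prod (g := fun _ => 1 / 2 + g) (fun i _ => signMass_nonneg hγ _ _)
    fun i _ => ?_).trans (by simp)
  have := abs_le.1 (hg i)
  rcases Int.units_eq_one_or (w i) with h | h <;> simp [signMass, h] <;> linarith

/-- If two windows of length `k` at distance `d` read the same word then the sequence is
`d`-periodic over both of them, hence determined by `d` signs. -/
theorem sum_nuMeasure_real_hit_inter_hit_le {γ : ℕ+ → ℝ}
    (hγ : ∀ n, γ n ∈ Set.Ioo (-(1 / 2) : ℝ) (1 / 2)) {k d t : ℕ} (hd : 1 ≤ d) {g : ℝ}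
    (hg : ∀ i : ℕ, |γ (Nat.succPNat (t + i))| ≤ g) :
    ∑ w : Fin k → ℤˣ, (nuMeasure γ).real (hit w t ∩ hit w (t + d))
      ≤ 2 ^ d * (1 / 2 + g) ^ (k + d) := by
  have := isProbabilityMeasure_nuMeasure hγ
  rw [← measureReal_biUnion_finset]
  · have hsub : (⋃ w ∈ (Finset.univ : Finset (Fin k → ℤˣ)), hit w t ∩ hit w (t + d)) ⊆
        ⋃ v ∈ (Finset.univ : Finset (Fin d → ℤˣ)),
          hit (fun i : Fin (k + d) => v ⟨i % d, Nat.mod_lt _ hd⟩) t := by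
      intro x hx
      simp only [Finset.mem_univ, Set.iUnion_true, Set.mem_iUnion] at hx ⊢
      obtain ⟨w, hw1, hw2⟩ := hx
      refine ⟨fun i => x (Nat.succPNat (t + i)), ?_⟩
      rintro ⟨i, hi⟩
      simp only
      induction i using Nat.strong_induction_on with
      | _ i ih =>
        rcases lt_or_ge i d with hid | hid
        · rw [Nat.mod_eq_of_lt hid]
        · have h1 := ih (i - d) (by omega) (by omega)
          rw [← Nat.mod_eq_sub_mod hid] at h1
          rw [← h1]
          have h2 := hw1 ⟨i - d, by omega⟩
          have h3 := hw2 ⟨i - d, by omega⟩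
          simp only at h2 h3
          rw [h2, ← h3]
          congr 2
          omega
    refine (measureReal_mono hsub (measure_ne_top _ _)).trans ((measureReal_biUnion_finset_le _ _).trans ?_)
    refine (Finset.sum_le_sum fun v _ => nuMeasure_real_hit_le hγ _ hg).trans ?_
    simp
  · intro w _ w' _ hww
    refine Set.disjoint_left.2 fun x hx hx' => hww ?_
    ext i
    rw [← hx.1 i, hx'.1 i]
  · exact fun w _ => (measurableSet_hit w t).inter (measurableSet_hit w _)

/-- The occurrence of `w` at time `T + t` is independent of the number of occurrences in windows that
end before that time. -/
theorem integral_pow_countEvents_mul_indicator {γ : ℕ+ → ℝ}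
    (hγ : ∀ n, γ n ∈ Set.Ioo (-(1 / 2) : ℝ) (1 / 2)) {k : ℕ} (w : Fin k → ℤˣ) (T t : ℕ) (s : ℝ) :
    ∫ x, s ^ countEvents (fun u => hit w (T + u)) (t + 1 - k) x
        * (hit w (T + t)).indicator (fun _ => (1 : ℝ)) x ∂nuMeasure γ
      = (∫ x, s ^ countEvents (fun u => hit w (T + u)) (t + 1 - k) x ∂nuMeasure γ)
        * (nuMeasure γ).real (hit w (T + t)) := by
  classical
  have := isProbabilityMeasure_nuMeasure hγ
  have hind := (iIndepFun_eval_succPNat hγ).indepFun_finset (Finset.range (T + t))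
    (Finset.Ico (T + t) (T + t + k)) (Finset.disjoint_left.2 fun a h1 h2 => by
      simp only [Finset.mem_range, Finset.mem_Ico] at h1 h2; omega)
    fun i => measurable_pi_apply _
  let F : (Finset.range (T + t) → ℤˣ) → ℝ := fun y =>
    s ^ ((Finset.range (t + 1 - k)).filter fun u =>
      ∀ i : Fin k, ∀ h : T + u + i ∈ Finset.range (T + t), y ⟨T + u + i, h⟩ = w i).card
  let G : (Finset.Ico (T + t) (T + t + k) → ℤˣ) → ℝ := fun y =>
    if ∀ i : Fin k, ∀ h : T + t + i ∈ Finset.Ico (T + t) (T + t + k), y ⟨T + t + i, h⟩ = w i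
      then 1 else 0
  have h2 := hind.comp (Measurable.of_discrete (f := F)) (Measurable.of_discrete (f := G))
  have hF : (F ∘ fun (a : ℕ+ → ℤˣ) (i : Finset.range (T + t)) => a (Nat.succPNat i))
      = fun x => s ^ countEvents (fun u => hit w (T + u)) (t + 1 - k) x := by
    ext x
    simp only [F, Function.comp, countEvents]
    congr 2
    refine Finset.filter_congr fun u hu => ?_
    simp only [Finset.mem_range] at hu
    refine forall_congr' fun i => ?_
    have hm : T + u + i ∈ Finset.range (T + t) := by simp; omega
    exact ⟨fun h => h hm, fun h _ => h⟩
  have hG : (G ∘ fun (a : ℕ+ → ℤˣ) (i : Finset.Ico (T + t) (T + t + k)) => a (Nat.succPNat i))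
      = (hit w (T + t)).indicator (fun _ => (1 : ℝ)) := by
    ext x
    simp only [G, Function.comp, Set.indicator, hit, Set.mem_ofPred_eq]
    congr 1
    refine propext (forall_congr' fun i => ?_)
    have hm : T + t + i ∈ Finset.Ico (T + t) (T + t + k) := by simp
    exact ⟨fun h => h hm, fun h _ => h⟩
  rw [hF, hG] at h2
  rw [h2.integral_fun_mul_eq_mul_integral]
  · rw [integral_indicator_const _ (measurableSet_hit w _)]; simp
  · exact ((measurable_from_nat (f := fun j : ℕ => s ^ j)).comp
      (measurable_countEvents (fun u => measurableSet_hit w _) _)).aestronglyMeasurable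
  · exact (measurable_const.indicator (measurableSet_hit w _)).aestronglyMeasurable

/-! ### The probability generating function of the number of occurrences -/

/-- The probability generating function of the number of occurrences in `x` of a uniformly
distributed random `k`-word. -/
noncomputable def genFun (s : ℝ) (k : ℕ) (x : ℕ+ → ℤˣ) : ℝ :=
  (∑ w : Fin k → ℤˣ, s ^ occurrences x k w) / 2 ^ k

theorem card_words (k : ℕ) : Fintype.card (Fin k → ℤˣ) = 2 ^ k := by
  simp

theorem uniformOn_real_occurrences (x : ℕ+ → ℤˣ) (k n : ℕ) :
    (uniformOn (Set.univ : Set (Fin k → ℤˣ))).real {w | occurrences x k w = n}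
      = (∑ w : Fin k → ℤˣ, if n = occurrences x k w then (1 : ℝ) else 0) / 2 ^ k := by
  classical
  have h : {w : Fin k → ℤˣ | occurrences x k w = n}
      = ((Finset.univ.filter fun w => n = occurrences x k w : Finset (Fin k → ℤˣ)) : Set _) := by
    ext w; simp [eq_comm]
  rw [measureReal_def, uniformOn_univ, h, Measure.count_apply_finset, card_words]
  simp

theorem hasSum_uniformOn_mul_pow (x : ℕ+ → ℤˣ) (k : ℕ) (s : ℝ) :
    HasSum (fun n => (uniformOn (Set.univ : Set (Fin k → ℤˣ))).real {w | occurrences x k w = n}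
      * s ^ n) (genFun s k x) := by
  simp only [uniformOn_real_occurrences, div_mul_eq_mul_div, Finset.sum_mul, genFun]
  refine HasSum.div_const (hasSum_sum fun w _ => ?_) _
  have := hasSum_ite_eq (occurrences x k w) (s ^ occurrences x k w)
  refine this.congr_fun fun n => ?_
  by_cases h : n = occurrences x k w <;> simp [h]

theorem hasSum_poisson_mul_pow (s : ℝ) :
    HasSum (fun n : ℕ => Real.exp (-1) / n ! * s ^ n) (Real.exp (s - 1)) := by
  have h := (NormedSpace.expSeries_div_hasSum_exp (𝔸 := ℝ) s).mul_left (Real.exp (-1))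
  rw [← Real.exp_eq_exp_ℝ, ← Real.exp_add, neg_add_eq_sub] at h
  refine h.congr_fun fun n => ?_
  ring

theorem simplyPoissonGeneric_of_tendsto_genFun {x : ℕ+ → ℤˣ}
    (h : ∀ m : ℕ, Tendsto (fun k => genFun (1 / ((m : ℝ) + 1)) k x) atTop
      (nhds (Real.exp (1 / ((m : ℝ) + 1) - 1)))) : SimplyPoissonGeneric x := by
  intro n
  refine tendsto_of_tendsto_tsum_mul_pow (q := fun n => Real.exp (-1) / n !)
    (p := fun k n => (uniformOn (Set.univ : Set (Fin k → ℤˣ))).real {w | occurrences x k w = n})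
    (fun _ _ => measureReal_nonneg) (fun k => ?_) (fun n => by positivity) ?_ (fun m => ?_) n
  · have := hasSum_uniformOn_mul_pow x k 1
    simpa [genFun] using this
  · simpa using hasSum_poisson_mul_pow 1
  · simp only [(hasSum_uniformOn_mul_pow x _ _).tsum_eq, (hasSum_poisson_mul_pow _).tsum_eq]
    exact h m

theorem measurable_occurrences (k : ℕ) (w : Fin k → ℤˣ) :
    Measurable fun x => occurrences x k w := by
  simp only [occurrences_eq_countEvents]
  exact measurable_countEvents (measurableSet_hit w) _

theorem measurable_pow_occurrences (s : ℝ) (k : ℕ) (w : Fin k → ℤˣ) :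
    Measurable fun x => s ^ occurrences x k w :=
  (measurable_from_nat (f := fun j : ℕ => s ^ j)).comp (measurable_occurrences k w)

theorem measurable_genFun (s : ℝ) (k : ℕ) : Measurable (genFun s k) :=
  (Finset.measurable_sum _ fun w _ => measurable_pow_occurrences s k w).div_const _

theorem genFun_mem_Icc {s : ℝ} (h0 : 0 ≤ s) (h1 : s ≤ 1) (k : ℕ) (x : ℕ+ → ℤˣ) :
    genFun s k x ∈ Set.Icc (0 : ℝ) 1 := by
  refine ⟨div_nonneg (Finset.sum_nonneg fun w _ => pow_nonneg h0 _) (by positivity), ?_⟩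
  rw [genFun, div_le_one (by positivity)]
  refine (Finset.sum_le_sum (g := fun _ => 1) fun w _ => pow_le_one₀ h0 h1).trans ?_
  simp

theorem occurrences_congr {x y : ℕ+ → ℤˣ} {k : ℕ}
    (h : ∀ t < 2 ^ k + k, x (Nat.succPNat t) = y (Nat.succPNat t)) (w : Fin k → ℤˣ) :
    occurrences x k w = occurrences y k w := by
  rw [occurrences, occurrences]
  congr 1
  refine Finset.filter_congr fun t ht => forall_congr' fun i => ?_
  rw [h _ (by have := Finset.mem_range.1 ht; omega)]

/-- Changing one sign affects only the `k` windows which contain it, so that the number of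
occurrences changes for at most `2 * k` words. -/
theorem abs_genFun_sub_genFun_le {s : ℝ} (h0 : 0 ≤ s) (h1 : s ≤ 1) {k : ℕ} {x y : ℕ+ → ℤˣ} {m : ℕ}
    (h : ∀ t, t ≠ m → x (Nat.succPNat t) = y (Nat.succPNat t)) :
    |genFun s k x - genFun s k y| ≤ 2 * k / 2 ^ k := by
  classical
  let word : (ℕ+ → ℤˣ) → ℕ → Fin k → ℤˣ := fun z t i => z (Nat.succPNat (t + i))
  let B : Finset (Fin k → ℤˣ) := (Finset.Ico (m + 1 - k) (m + 1)).image (word x)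
    ∪ (Finset.Ico (m + 1 - k) (m + 1)).image (word y)
  have hB : (B.card : ℝ) ≤ 2 * k := by
    have e1 : (Finset.Ico (m + 1 - k) (m + 1)).card ≤ k := by rw [Nat.card_Ico]; omega
    have : B.card ≤ 2 * k := (Finset.card_union_le _ _).trans (by
      have a1 := Finset.card_image_le (s := Finset.Ico (m + 1 - k) (m + 1)) (f := word x)
      have a2 := Finset.card_image_le (s := Finset.Ico (m + 1 - k) (m + 1)) (f := word y)
      omega)
    exact_mod_cast this
  have hout : ∀ w, w ∉ B → occurrences x k w = occurrences y k w := by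
    intro w hw
    rw [occurrences, occurrences]
    congr 1
    refine Finset.filter_congr fun t _ => ?_
    by_cases ht : t ∈ Finset.Ico (m + 1 - k) (m + 1)
    · have e1 : ¬ ∀ i : Fin k, x (Nat.succPNat (t + i)) = w i := fun hx =>
        hw (Finset.mem_union_left _ (Finset.mem_image.2 ⟨t, ht, funext hx⟩))
      have e2 : ¬ ∀ i : Fin k, y (Nat.succPNat (t + i)) = w i := fun hx =>
        hw (Finset.mem_union_right _ (Finset.mem_image.2 ⟨t, ht, funext hx⟩))
      exact iff_of_false e1 e2
    · refine forall_congr' fun i => ?_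
      rw [h _ (by have := i.2; simp only [Finset.mem_Ico] at ht; omega)]
  rw [genFun, genFun, ← sub_div, ← Finset.sum_sub_distrib, abs_div,
    abs_of_pos (show (0 : ℝ) < 2 ^ k by positivity)]
  gcongr
  calc |∑ w : Fin k → ℤˣ, (s ^ occurrences x k w - s ^ occurrences y k w)|
      ≤ ∑ w : Fin k → ℤˣ, |s ^ occurrences x k w - s ^ occurrences y k w| :=
        Finset.abs_sum_le_sum_abs _ _
    _ = ∑ w ∈ B, |s ^ occurrences x k w - s ^ occurrences y k w| := by
        refine (Finset.sum_subset (Finset.subset_univ B) fun w _ hw => ?_).symm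
        rw [hout w hw]; simp
    _ ≤ ∑ w ∈ B, (1 : ℝ) := by
        refine Finset.sum_le_sum fun w _ => ?_
        rw [abs_le]
        have a1 := pow_le_one₀ h0 h1 (n := occurrences x k w)
        have a2 := pow_le_one₀ h0 h1 (n := occurrences y k w)
        have a3 := pow_nonneg h0 (occurrences x k w)
        have a4 := pow_nonneg h0 (occurrences y k w)
        constructor <;> linarith
    _ ≤ 2 * k := by simpa using hB

theorem integrable_genFun {s : ℝ} (h0 : 0 ≤ s) (h1 : s ≤ 1) (k : ℕ) (μ : Measure (ℕ+ → ℤˣ))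
    [IsProbabilityMeasure μ] : Integrable (genFun s k) μ := by
  refine Integrable.of_bound (C := 1) (measurable_genFun s k).aestronglyMeasurable
    (.of_forall fun x => ?_)
  have := genFun_mem_Icc h0 h1 k x
  rw [Real.norm_of_nonneg this.1]
  exact this.2

/-- The variance of the generating function: it depends on `2 ^ k + k` signs only, each of which
changes it by at most `2 * k / 2 ^ k`. -/
theorem integral_genFun_sub_sq_le {γ : ℕ+ → ℝ}
    (hγ : ∀ n, γ n ∈ Set.Ioo (-(1 / 2) : ℝ) (1 / 2)) {s : ℝ} (h0 : 0 ≤ s) (h1 : s ≤ 1) (k : ℕ) :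
    ∫ x, (genFun s k x - ∫ y, genFun s k y ∂nuMeasure γ) ^ 2 ∂nuMeasure γ
      ≤ ((2 : ℝ) ^ k + k) * (2 * k / 2 ^ k) ^ 2 := by
  have := fun n => isProbabilityMeasure_signMeasure (hγ n)
  have := isProbabilityMeasure_nuMeasure hγ
  set N := 2 ^ k + k with hN
  have hmp : (nuMeasure γ).map (fun x (i : Fin N) => x (Nat.succPNat i))
      = Measure.pi fun i : Fin N => signMeasure (γ (Nat.succPNat i)) := by
    have hind := (iIndepFun_eval_succPNat hγ).precomp (Fin.val_injective (n := N))
    rw [iIndepFun_iff_map_fun_eq_pi_map fun i => (measurable_pi_apply _).aemeasurable] at hind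
    rw [hind]
    congr 1
    ext1 i
    exact Measure.infinitePi_map_eval _ _
  let ex : (Fin N → ℤˣ) → ℕ+ → ℤˣ := fun y n => if h : (n : ℕ) - 1 < N then y ⟨(n : ℕ) - 1, h⟩ else 1
  have hex : ∀ (y : Fin N → ℤˣ) t (ht : t < N), ex y (Nat.succPNat t) = y ⟨t, ht⟩ := by
    intro y t ht
    simp [ex, ht]
  have hgen : ∀ x, genFun s k x = genFun s k (ex fun i => x (Nat.succPNat i)) := by
    intro x
    rw [genFun, genFun]
    congr 1
    refine Finset.sum_congr rfl fun w _ => ?_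
    rw [occurrences_congr (y := ex fun i => x (Nat.succPNat i)) fun t ht => ?_]
    exact (hex (fun i => x (Nat.succPNat i)) t ht).symm
  have htr : ∀ G : ℝ → ℝ, ∫ x, G (genFun s k x) ∂nuMeasure γ
      = ∫ y, G (genFun s k (ex y)) ∂Measure.pi fun i : Fin N => signMeasure (γ (Nat.succPNat i)) := by
    intro G
    rw [← hmp, integral_map]
    · exact integral_congr_ae (.of_forall fun x => by simp only [hgen x])
    · exact (measurable_pi_lambda _ fun i => measurable_pi_apply _).aemeasurable
    · exact (Measurable.of_discrete).aestronglyMeasurable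
  rw [htr fun a => (a - ∫ y, genFun s k y ∂nuMeasure γ) ^ 2, htr fun a => a]
  have hNr : (2 : ℝ) ^ k + k = N := by rw [hN]; push_cast; rfl
  rw [hNr]
  refine integral_sub_integral_sq_pi_le N _ (fun y => genFun s k (ex y)) fun y i a => ?_
  refine abs_genFun_sub_genFun_le h0 h1 (m := i) fun t ht => ?_
  by_cases htN : t < N
  · rw [hex _ _ htN, hex _ _ htN, Function.update_of_ne]
    exact fun h => ht (by rw [← h])
  · simp [ex, htN]

theorem ae_tendsto_genFun_sub_integral {γ : ℕ+ → ℝ}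
    (hγ : ∀ n, γ n ∈ Set.Ioo (-(1 / 2) : ℝ) (1 / 2)) {s : ℝ} (h0 : 0 ≤ s) (h1 : s ≤ 1) :
    ∀ᵐ x ∂nuMeasure γ, Tendsto (fun k => genFun s k x - ∫ y, genFun s k y ∂nuMeasure γ) atTop
      (nhds 0) := by
  have := isProbabilityMeasure_nuMeasure hγ
  refine ae_tendsto_zero_of_summable_integral_sq (fun k => (measurable_genFun s k).sub_const _)
    (fun k => ?_) ?_
  · refine Integrable.of_bound (C := 1)
      (((measurable_genFun s k).sub_const _).pow_const 2).aestronglyMeasurable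
      (.of_forall fun x => ?_)
    obtain ⟨a1, a2⟩ := genFun_mem_Icc h0 h1 k x
    have b1 : 0 ≤ ∫ y, genFun s k y ∂nuMeasure γ :=
      integral_nonneg fun y => (genFun_mem_Icc h0 h1 k y).1
    have b2 : ∫ y, genFun s k y ∂nuMeasure γ ≤ 1 := by
      have := integral_mono (integrable_genFun h0 h1 k (nuMeasure γ)) (integrable_const 1)
        fun y => (genFun_mem_Icc h0 h1 k y).2
      simpa using this
    rw [Real.norm_of_nonneg (sq_nonneg _)]
    nlinarith
  · have hhalf : ‖(1 / 2 : ℝ)‖ < 1 := by norm_num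
    have hsum : Summable fun k : ℕ => 8 * ((k : ℝ) ^ 2 * (1 / 2 : ℝ) ^ k) :=
      (summable_pow_mul_geometric_of_norm_lt_one 2 hhalf).mul_left 8
    refine Summable.of_nonneg_of_le (fun k => integral_nonneg fun x => sq_nonneg _)
      (fun k => (integral_genFun_sub_sq_le hγ h0 h1 k).trans ?_) hsum
    have hk : (k : ℝ) ≤ 2 ^ k := by exact_mod_cast Nat.lt_two_pow_self.le
    have e1 : (2 : ℝ) ^ k + k ≤ 2 * 2 ^ k := by linarith
    calc ((2 : ℝ) ^ k + k) * (2 * k / 2 ^ k) ^ 2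
        ≤ 2 * 2 ^ k * (2 * k / 2 ^ k) ^ 2 := by gcongr
      _ = 8 * ((k : ℝ) ^ 2 * (1 / 2) ^ k) := by
          rw [one_div, inv_pow]
          field_simp
          ring

/-! ### Small biases: convergence of the averaged generating function -/

theorem tendsto_two_pow_half_div_two_pow :
    Tendsto (fun k : ℕ => (2 : ℝ) ^ (k / 2) / 2 ^ k) atTop (nhds 0) := by
  have h1 : Tendsto (fun k : ℕ => k - k / 2) atTop atTop :=
    tendsto_atTop_mono (f := fun k : ℕ => k / 2) (fun k => by omega)
      (Nat.tendsto_div_const_atTop (by norm_num))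
  have h2 := (tendsto_pow_atTop_nhds_zero_of_lt_one (r := (1 / 2 : ℝ)) (by norm_num)
    (by norm_num)).comp h1
  refine h2.congr fun k => ?_
  have : (2 : ℝ) ^ k = 2 ^ (k / 2) * 2 ^ (k - k / 2) := by
    rw [← pow_add]; congr 1; omega
  simp only [Function.comp]
  rw [this, one_div, inv_pow]
  field_simp

theorem sum_Ico_add_eq_sum_range {f : ℕ → ℝ} {T n : ℕ} :
    ∑ t ∈ Finset.Ico T (T + n), f t = ∑ t ∈ Finset.range n, f (T + t) := by
  rw [Finset.sum_Ico_eq_sum_range]; simp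

/-- The occurrences before time `T` cost at most the expected number of such occurrences. -/
theorem abs_integral_pow_occurrences_sub_le {γ : ℕ+ → ℝ}
    (hγ : ∀ n, γ n ∈ Set.Ioo (-(1 / 2) : ℝ) (1 / 2)) {s : ℝ} (h0 : 0 ≤ s) (h1 : s ≤ 1) {k T n : ℕ}
    (hT : T + n = 2 ^ k) (w : Fin k → ℤˣ) :
    |∫ x, s ^ occurrences x k w ∂nuMeasure γ
        - ∫ x, s ^ countEvents (fun t => hit w (T + t)) n x ∂nuMeasure γ|
      ≤ ∑ t ∈ Finset.range T, (nuMeasure γ).real (hit w t) := by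
  have := isProbabilityMeasure_nuMeasure hγ
  have hcount : ∀ x, countEvents (hit w) (2 ^ k) x
      = countEvents (fun t => hit w (T + t)) n x + countEvents (hit w) T x := by
    intro x
    have e1 := countEvents_eq_add_sum (hit w) (show T ≤ T + n by omega) x
    have e2 := countEvents_eq_add_sum (fun t => hit w (T + t)) (Nat.zero_le n) x
    rw [sum_Ico_add_eq_sum_range] at e1
    rw [← Finset.range_eq_Ico] at e2
    have e3 : countEvents (fun t => hit w (T + t)) 0 x = 0 := by simp [countEvents]
    rw [e3] at e2
    rw [← hT]
    have : (countEvents (hit w) (T + n) x : ℝ)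
        = countEvents (fun t => hit w (T + t)) n x + countEvents (hit w) T x := by
      rw [e1, e2]; simp [add_comm]
    exact_mod_cast this
  have hint : ∀ {f : (ℕ+ → ℤˣ) → ℕ}, Measurable f → Integrable (fun x => s ^ f x) (nuMeasure γ) := by
    intro f hf
    refine Integrable.of_bound (C := 1) ?_ (.of_forall fun x => ?_)
    · exact ((measurable_from_nat (f := fun j : ℕ => s ^ j)).comp hf).aestronglyMeasurable
    · rw [Real.norm_of_nonneg (pow_nonneg h0 _)]; exact pow_le_one₀ h0 h1
  have i1 := hint (measurable_occurrences k w)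
  have i2 := hint (measurable_countEvents (fun t => measurableSet_hit w (T + t)) n)
  rw [← integral_sub i1 i2]
  refine abs_integral_le_integral_abs.trans ?_
  have hr : ∑ t ∈ Finset.range T, (nuMeasure γ).real (hit w t)
      = ∫ x, ∑ t ∈ Finset.range T, (hit w t).indicator (fun _ => (1 : ℝ)) x ∂nuMeasure γ := by
    rw [integral_finsetSum _ fun t _ => (integrable_const 1).indicator (measurableSet_hit w t)]
    refine Finset.sum_congr rfl fun t _ => ?_
    rw [integral_indicator_const _ (measurableSet_hit w t)]; simp
  rw [hr]
  refine integral_mono (i1.sub i2).abs (integrable_finsetSum _ fun t _ =>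
    (integrable_const 1).indicator (measurableSet_hit w t)) fun x => ?_
  simp only
  rw [occurrences_eq_countEvents, hcount, abs_sub_comm]
  refine (abs_pow_sub_pow_add_le h0 h1 _ _).trans (le_of_eq ?_)
  have e2 := countEvents_eq_add_sum (hit w) (Nat.zero_le T) x
  rw [e2, ← Finset.range_eq_Ico]
  simp [countEvents]

/-- The mean of the local dependence error terms over all words. -/
theorem sum_local_dependence_le {γ : ℕ+ → ℝ}
    (hγ : ∀ n, γ n ∈ Set.Ioo (-(1 / 2) : ℝ) (1 / 2)) {k T n : ℕ} {g : ℝ} (hg0 : 0 ≤ g)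
    (hg : ∀ t, T ≤ t → |γ (Nat.succPNat t)| ≤ g) :
    ∑ w : Fin k → ℤˣ, ∑ t ∈ Finset.range n, ((nuMeasure γ).real (hit w (T + t)) ^ 2
        + ∑ u ∈ Finset.Ico (t + 1 - k) t, ((nuMeasure γ).real (hit w (T + u) ∩ hit w (T + t))
          + (nuMeasure γ).real (hit w (T + u)) * (nuMeasure γ).real (hit w (T + t))))
      ≤ n * ((2 * k + 1) * (2 ^ k * (1 / 2 + g) ^ (k + k))) := by
  set B := (2 : ℝ) ^ k * (1 / 2 + g) ^ (k + k) with hB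
  have hB0 : 0 ≤ B := by positivity
  have hmul : (1 / 2 + g) ^ k ≤ B := by
    have e : B = (2 * (1 / 2 + g)) ^ k * (1 / 2 + g) ^ k := by rw [hB, mul_pow, pow_add]; ring
    rw [e]
    exact le_mul_of_one_le_left (by positivity) (one_le_pow₀ (by linarith))
  have hprod : ∀ t u, T ≤ t → ∑ w : Fin k → ℤˣ,
      (nuMeasure γ).real (hit w u) * (nuMeasure γ).real (hit w t) ≤ B := by
    intro t u ht
    calc ∑ w : Fin k → ℤˣ, (nuMeasure γ).real (hit w u) * (nuMeasure γ).real (hit w t)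
        ≤ ∑ w : Fin k → ℤˣ, (nuMeasure γ).real (hit w u) * (1 / 2 + g) ^ k :=
          Finset.sum_le_sum fun w _ => mul_le_mul_of_nonneg_left
            (nuMeasure_real_hit_le hγ w fun i => hg _ (by omega)) measureReal_nonneg
      _ ≤ B := by rwa [← Finset.sum_mul, sum_nuMeasure_real_hit hγ, one_mul]
  have hinter : ∀ t u, u < t → t ≤ u + k → ∑ w : Fin k → ℤˣ,
      (nuMeasure γ).real (hit w (T + u) ∩ hit w (T + t)) ≤ B := by
    intro t u hut htk
    obtain ⟨d, rfl⟩ := Nat.exists_eq_add_of_lt hut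
    rw [show T + (u + d + 1) = T + u + (d + 1) by ring]
    refine (sum_nuMeasure_real_hit_inter_hit_le hγ (by omega) fun i => hg _ (by omega)).trans ?_
    have e1 : (2 : ℝ) ^ (d + 1) * (1 / 2 + g) ^ (k + (d + 1))
        = (2 * (1 / 2 + g)) ^ (d + 1) * (1 / 2 + g) ^ k := by rw [mul_pow, pow_add _ k]; ring
    have e2 : B = (2 * (1 / 2 + g)) ^ k * (1 / 2 + g) ^ k := by rw [hB, mul_pow, pow_add]; ring
    rw [e1, e2]
    exact mul_le_mul_of_nonneg_right (pow_le_pow_right₀ (by linarith) (by omega)) (by positivity)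
  rw [Finset.sum_comm]
  calc _ ≤ ∑ t ∈ Finset.range n, (2 * k + 1) * B := by
        refine Finset.sum_le_sum fun t _ => ?_
        rw [Finset.sum_add_distrib, Finset.sum_comm]
        have a1 : ∑ w : Fin k → ℤˣ, (nuMeasure γ).real (hit w (T + t)) ^ 2 ≤ B := by
          simp only [sq]
          exact hprod _ _ (by omega)
        have a2 : ∑ u ∈ Finset.Ico (t + 1 - k) t, ∑ w : Fin k → ℤˣ,
            ((nuMeasure γ).real (hit w (T + u) ∩ hit w (T + t))
              + (nuMeasure γ).real (hit w (T + u)) * (nuMeasure γ).real (hit w (T + t)))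
            ≤ ∑ u ∈ Finset.Ico (t + 1 - k) t, 2 * B := by
          refine Finset.sum_le_sum fun u hu => ?_
          rw [Finset.mem_Ico] at hu
          rw [Finset.sum_add_distrib]
          have b1 := hinter t u (by omega) (by omega)
          have b2 := hprod (T + t) (T + u) (by omega)
          linarith
        have a3 : ∑ u ∈ Finset.Ico (t + 1 - k) t, 2 * B ≤ k * (2 * B) := by
          rw [Finset.sum_const, nsmul_eq_mul, Nat.card_Ico]
          have : t - (t + 1 - k) ≤ k := by omega
          gcongr
        linarith
    _ = n * ((2 * k + 1) * B) := by simp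

/-- The second moment over the words of the deviation from one of the conditional mean number of
occurrences after time `T`. -/
theorem sum_sq_sum_nuMeasure_real_hit_sub_one_le {γ : ℕ+ → ℝ}
    (hγ : ∀ n, γ n ∈ Set.Ioo (-(1 / 2) : ℝ) (1 / 2)) {k T n : ℕ} {g : ℝ} (hT : T + n = 2 ^ k)
    (hg : ∀ t, T ≤ t → |γ (Nat.succPNat t)| ≤ g) :
    (∑ w : Fin k → ℤˣ, (∑ t ∈ Finset.range n, (nuMeasure γ).real (hit w (T + t)) - 1) ^ 2) / 2 ^ k
      ≤ Real.exp (4 * (k * g ^ 2)) - 1 + 2 * (T / 2 ^ k) := by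
  have hTr : (n : ℝ) = 2 ^ k - T := by
    have : ((T + n : ℕ) : ℝ) = 2 ^ k := by rw [hT]; push_cast; rfl
    push_cast at this; linarith
  have h2 : (0 : ℝ) < 2 ^ k := by positivity
  have hn : (n : ℝ) ≤ 2 ^ k := by rw [hTr]; linarith [(Nat.cast_nonneg T : (0 : ℝ) ≤ T)]
  have hpair : ∀ t t', T ≤ t → T ≤ t' → ∑ w : Fin k → ℤˣ,
      (nuMeasure γ).real (hit w t) * (nuMeasure γ).real (hit w t')
        ≤ Real.exp (4 * (k * g ^ 2)) / 2 ^ k := by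
    intro t t' ht ht'
    rw [sum_nuMeasure_real_hit_mul_hit hγ]
    have hgg : ∀ i : ℕ, |γ (Nat.succPNat (t + i)) * γ (Nat.succPNat (t' + i))| ≤ g ^ 2 := by
      intro i
      rw [abs_mul, sq]
      exact mul_le_mul (hg _ (by omega)) (hg _ (by omega)) (abs_nonneg _)
        ((abs_nonneg _).trans (hg _ ht))
    calc ∏ i : Fin k, (1 / 2 + 2 * γ (Nat.succPNat (t + i)) * γ (Nat.succPNat (t' + i)))
        ≤ ∏ _i : Fin k, (Real.exp (4 * g ^ 2) / 2) := by
          refine Finset.prod_le_prod (fun i _ => ?_) fun i _ => ?_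
          · have a1 := hγ (Nat.succPNat (t + i))
            have a2 := hγ (Nat.succPNat (t' + i))
            have : |γ (Nat.succPNat (t + i)) * γ (Nat.succPNat (t' + i))| ≤ 1 / 2 * (1 / 2) := by
              rw [abs_mul]
              exact mul_le_mul (abs_le.2 ⟨a1.1.le, a1.2.le⟩) (abs_le.2 ⟨a2.1.le, a2.2.le⟩)
                (abs_nonneg _) (by norm_num)
            have := (abs_le.1 this).1
            linarith
          · have a1 := (abs_le.1 (hgg i)).2
            have a2 := Real.add_one_le_exp (4 * g ^ 2)
            linarith
      _ = Real.exp (4 * (k * g ^ 2)) / 2 ^ k := by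
          rw [Finset.prod_const, Finset.card_univ, Fintype.card_fin, div_pow, ← Real.exp_nat_mul]
          congr 2; ring
  have hsq : ∑ w : Fin k → ℤˣ, (∑ t ∈ Finset.range n, (nuMeasure γ).real (hit w (T + t))) ^ 2
      ≤ 2 ^ k * Real.exp (4 * (k * g ^ 2)) := by
    have hsq' : ∀ w : Fin k → ℤˣ, (∑ t ∈ Finset.range n, (nuMeasure γ).real (hit w (T + t))) ^ 2
        = ∑ t ∈ Finset.range n, ∑ t' ∈ Finset.range n,
          (nuMeasure γ).real (hit w (T + t)) * (nuMeasure γ).real (hit w (T + t')) := fun w => by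
      rw [sq, Finset.sum_mul_sum]
    simp only [hsq']
    rw [Finset.sum_comm]
    calc _ ≤ ∑ t ∈ Finset.range n, ∑ t' ∈ Finset.range n, Real.exp (4 * (k * g ^ 2)) / 2 ^ k := by
          refine Finset.sum_le_sum fun t _ => ?_
          rw [Finset.sum_comm]
          exact Finset.sum_le_sum fun t' _ => hpair _ _ (by omega) (by omega)
      _ = n * (n * (Real.exp (4 * (k * g ^ 2)) / 2 ^ k)) := by simp
      _ ≤ 2 ^ k * (2 ^ k * (Real.exp (4 * (k * g ^ 2)) / 2 ^ k)) := by gcongr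
      _ = 2 ^ k * Real.exp (4 * (k * g ^ 2)) := by field_simp
  have hlin : ∑ w : Fin k → ℤˣ, ∑ t ∈ Finset.range n, (nuMeasure γ).real (hit w (T + t)) = n := by
    rw [Finset.sum_comm]
    simp [sum_nuMeasure_real_hit hγ]
  rw [div_le_iff₀ h2]
  have hexp : ∑ w : Fin k → ℤˣ, (∑ t ∈ Finset.range n, (nuMeasure γ).real (hit w (T + t)) - 1) ^ 2
      = ∑ w : Fin k → ℤˣ, (∑ t ∈ Finset.range n, (nuMeasure γ).real (hit w (T + t))) ^ 2
        - 2 * n + 2 ^ k := by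
    rw [← hlin, Finset.mul_sum, ← Finset.sum_sub_distrib]
    have : (2 : ℝ) ^ k = ∑ _w : Fin k → ℤˣ, 1 := by simp
    rw [this, ← Finset.sum_add_distrib]
    exact Finset.sum_congr rfl fun w _ => by ring
  rw [hexp, hTr]
  have : (Real.exp (4 * (k * g ^ 2)) - 1 + 2 * (T / 2 ^ k)) * 2 ^ k
      = 2 ^ k * Real.exp (4 * (k * g ^ 2)) - 2 ^ k + 2 * T := by field_simp
  rw [this]
  linarith

/-- Quantitative Poisson approximation of the generating function averaged over the words and
over `x`. -/
theorem abs_integral_genFun_sub_exp_le {γ : ℕ+ → ℝ}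
    (hγ : ∀ n, γ n ∈ Set.Ioo (-(1 / 2) : ℝ) (1 / 2)) {s : ℝ} (h0 : 0 ≤ s) (h1 : s ≤ 1)
    {k T : ℕ} {g : ℝ} (hk : 1 ≤ k) (hT : T ≤ 2 ^ k) (hg0 : 0 ≤ g)
    (hg : ∀ t, T ≤ t → |γ (Nat.succPNat t)| ≤ g) :
    |∫ x, genFun s k x ∂nuMeasure γ - Real.exp (s - 1)|
      ≤ T / 2 ^ k + (2 * k + 1) * (2 * (1 / 2 + g) ^ 2) ^ k
        + √(Real.exp (4 * (k * g ^ 2)) - 1 + 2 * (T / 2 ^ k)) := by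
  have := isProbabilityMeasure_nuMeasure hγ
  obtain ⟨n, hn⟩ := Nat.exists_eq_add_of_le hT
  have h2 : (0 : ℝ) < 2 ^ k := by positivity
  have hnr : (n : ℝ) ≤ 2 ^ k := by
    have : n ≤ 2 ^ k := by omega
    exact_mod_cast this
  set p : (Fin k → ℤˣ) → ℕ → ℝ := fun w t => (nuMeasure γ).real (hit w t) with hp
  set l : (Fin k → ℤˣ) → ℝ := fun w => ∑ t ∈ Finset.range n, (nuMeasure γ).real (hit w (T + t))
    with hl
  set E : (Fin k → ℤˣ) → ℝ := fun w => ∑ t ∈ Finset.range n, ((nuMeasure γ).real (hit w (T + t)) ^ 2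
        + ∑ u ∈ Finset.Ico (t + 1 - k) t, ((nuMeasure γ).real (hit w (T + u) ∩ hit w (T + t))
          + (nuMeasure γ).real (hit w (T + u)) * (nuMeasure γ).real (hit w (T + t)))) with hE
  have hword : ∀ w : Fin k → ℤˣ, |∫ x, s ^ occurrences x k w ∂nuMeasure γ - Real.exp (s - 1)|
      ≤ ∑ t ∈ Finset.range T, p w t + E w + |l w - 1| := by
    intro w
    have a1 := abs_integral_pow_occurrences_sub_le hγ h0 h1 hn.symm w
    have a2 := abs_integral_pow_countEvents_sub_exp_le (μ := nuMeasure γ)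
      (A := fun t => hit w (T + t)) (fun t => measurableSet_hit w _) h0 h1 hk
      (fun t => integral_pow_countEvents_mul_indicator hγ w T t s) n
    have hl0 : 0 ≤ l w := Finset.sum_nonneg fun _ _ => measureReal_nonneg
    have a3 : |Real.exp (-((1 - s) * l w)) - Real.exp (s - 1)| ≤ |l w - 1| := by
      have key : ∀ a b : ℝ, 0 ≤ a → a ≤ b → |Real.exp (-a) - Real.exp (-b)| ≤ b - a := by
        intro a b ha hab
        have e1 : Real.exp (-b) ≤ Real.exp (-a) := Real.exp_le_exp.2 (by linarith)
        have e2 : Real.exp (-a) ≤ 1 := Real.exp_le_one_iff.2 (by linarith)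
        have e3 : Real.exp (-b) = Real.exp (-a) * Real.exp (a - b) := by
          rw [← Real.exp_add]; congr 1; ring
        have e4 := Real.add_one_le_exp (a - b)
        rw [abs_of_nonneg (by linarith), e3]
        nlinarith [Real.exp_pos (-a)]
      have e5 : s - 1 = -((1 - s) * 1) := by ring
      rw [e5]
      rcases le_total (l w) 1 with h | h
      · refine (key _ _ (mul_nonneg (by linarith) hl0) (by nlinarith)).trans ?_
        rw [abs_of_nonpos (by linarith)]
        nlinarith
      · rw [abs_sub_comm]
        refine (key _ _ (by linarith) (by nlinarith)).trans ?_
        rw [abs_of_nonneg (by linarith)]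
        nlinarith
    calc _ ≤ |∫ x, s ^ occurrences x k w ∂nuMeasure γ
            - ∫ x, s ^ countEvents (fun t => hit w (T + t)) n x ∂nuMeasure γ|
          + |∫ x, s ^ countEvents (fun t => hit w (T + t)) n x ∂nuMeasure γ
            - Real.exp (-((1 - s) * l w))| + |Real.exp (-((1 - s) * l w)) - Real.exp (s - 1)| :=
          (abs_sub_le _ _ _).trans (add_le_add_left (abs_sub_le _ _ _) _)
      _ ≤ _ := add_le_add (add_le_add a1 a2) a3
  have hintg : ∫ x, genFun s k x ∂nuMeasure γ - Real.exp (s - 1)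
      = (∑ w : Fin k → ℤˣ, (∫ x, s ^ occurrences x k w ∂nuMeasure γ - Real.exp (s - 1))) / 2 ^ k := by
    simp only [genFun]
    rw [integral_div, integral_finsetSum _ fun w _ => ?_, Finset.sum_sub_distrib, sub_div]
    · congr 1
      rw [Finset.sum_const, Finset.card_univ, card_words, nsmul_eq_mul]
      push_cast
      field_simp
    · refine Integrable.of_bound (C := 1) (measurable_pow_occurrences s k w).aestronglyMeasurable
        (.of_forall fun x => ?_)
      rw [Real.norm_of_nonneg (pow_nonneg h0 _)]; exact pow_le_one₀ h0 h1
  have s1 : (∑ w : Fin k → ℤˣ, ∑ t ∈ Finset.range T, p w t) = T := by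
    rw [Finset.sum_comm]
    simp [hp, sum_nuMeasure_real_hit hγ]
  have s2 : (∑ w : Fin k → ℤˣ, E w) / 2 ^ k ≤ (2 * k + 1) * (2 * (1 / 2 + g) ^ 2) ^ k := by
    rw [div_le_iff₀ h2]
    refine (sum_local_dependence_le hγ hg0 hg).trans ?_
    rw [mul_comm]
    have e : (2 * (1 / 2 + g) ^ 2) ^ k = 2 ^ k * (1 / 2 + g) ^ (k + k) := by
      rw [mul_pow, ← pow_mul]; congr 2; ring
    rw [e]
    exact mul_le_mul_of_nonneg_left hnr (by positivity)
  have s3 : (∑ w : Fin k → ℤˣ, |l w - 1|) / 2 ^ k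
      ≤ √(Real.exp (4 * (k * g ^ 2)) - 1 + 2 * (T / 2 ^ k)) := by
    refine Real.le_sqrt_of_sq_le ?_
    refine le_trans ?_ (sum_sq_sum_nuMeasure_real_hit_sub_one_le hγ hn.symm hg)
    have cs := sq_sum_le_card_mul_sum_sq (s := Finset.univ) (f := fun w : Fin k → ℤˣ => |l w - 1|)
    simp only [sq_abs, Finset.card_univ, card_words] at cs
    push_cast at cs
    rw [div_pow, div_le_div_iff₀ (by positivity) h2]
    have := mul_le_mul_of_nonneg_right cs h2.le
    linarith
  rw [hintg, abs_div, abs_of_pos h2]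
  calc |∑ w : Fin k → ℤˣ, (∫ x, s ^ occurrences x k w ∂nuMeasure γ - Real.exp (s - 1))| / 2 ^ k
      ≤ (∑ w : Fin k → ℤˣ, (∑ t ∈ Finset.range T, p w t + E w + |l w - 1|)) / 2 ^ k := by
        gcongr
        exact (Finset.abs_sum_le_sum_abs _ _).trans (Finset.sum_le_sum fun w _ => hword w)
    _ = T / 2 ^ k + (∑ w : Fin k → ℤˣ, E w) / 2 ^ k + (∑ w : Fin k → ℤˣ, |l w - 1|) / 2 ^ k := by
        rw [Finset.sum_add_distrib, Finset.sum_add_distrib, s1, add_div, add_div]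
    _ ≤ _ := by gcongr

/-- Early occurrences have small expected number for any biases, so only the biases from time
`2 ^ (k / 2)` on need to be small. -/
theorem tendsto_integral_genFun {γ : ℕ+ → ℝ}
    (hγ : ∀ n, γ n ∈ Set.Ioo (-(1 / 2) : ℝ) (1 / 2)) {s : ℝ} (h0 : 0 ≤ s) (h1 : s ≤ 1)
    {g : ℕ → ℝ} (hg0 : ∀ k, 0 ≤ g k) (hg : Tendsto g atTop (nhds 0))
    (hkg : Tendsto (fun k : ℕ => k * g k ^ 2) atTop (nhds 0))
    (hb : ∀ᶠ k : ℕ in atTop, ∀ t, 2 ^ (k / 2) ≤ t → |γ (Nat.succPNat t)| ≤ g k) :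
    Tendsto (fun k => ∫ x, genFun s k x ∂nuMeasure γ) atTop (nhds (Real.exp (s - 1))) := by
  have hT := tendsto_two_pow_half_div_two_pow
  have l1 : Tendsto (fun k : ℕ => (2 * (k : ℝ) + 1) * (3 / 4 : ℝ) ^ k) atTop (nhds 0) := by
    have e1 := (tendsto_pow_const_mul_const_pow_of_abs_lt_one 1 (r := (3 / 4 : ℝ))
      (by rw [abs_of_pos] <;> norm_num)).const_mul 2
    have e2 := tendsto_pow_atTop_nhds_zero_of_lt_one (r := (3 / 4 : ℝ)) (by norm_num) (by norm_num)
    have e3 := e1.add e2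
    rw [mul_zero, add_zero] at e3
    exact e3.congr fun k => by ring
  have l2 : Tendsto (fun k : ℕ => √(Real.exp (4 * (k * g k ^ 2)) - 1
      + 2 * ((2 : ℝ) ^ (k / 2) / 2 ^ k))) atTop (nhds 0) := by
    have := ((((hkg.const_mul 4).rexp).sub_const 1).add (hT.const_mul 2)).sqrt
    simpa using this
  have l3 := (hT.add l1).add l2
  rw [add_zero, add_zero] at l3
  rw [tendsto_iff_dist_tendsto_zero]
  refine squeeze_zero' (.of_forall fun k => dist_nonneg) ?_ l3
  filter_upwards [hb, eventually_ge_atTop 1, hg.eventually (gt_mem_nhds (show (0 : ℝ) < 1 / 10 by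
    norm_num))] with k hbk hk hgk
  rw [Real.dist_eq]
  have hle : 2 ^ (k / 2) ≤ 2 ^ k := Nat.pow_le_pow_right (by norm_num) (Nat.div_le_self k 2)
  refine (abs_integral_genFun_sub_exp_le hγ h0 h1 hk hle (hg0 k) hbk).trans ?_
  push_cast
  have : 2 * (1 / 2 + g k) ^ 2 ≤ 3 / 4 := by nlinarith [hg0 k]
  gcongr

theorem div_eight_le_log {k n : ℕ} (hk : 2 ≤ k) (hn : 2 ^ (k / 2) ≤ n) :
    (k : ℝ) / 8 ≤ Real.log n := by
  have h1 : ((2 : ℝ) ^ (k / 2)) ≤ n := by exact_mod_cast hn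
  have h2 := Real.log_le_log (by positivity) h1
  rw [Real.log_pow] at h2
  have h3 : (k : ℝ) / 4 ≤ ((k / 2 : ℕ) : ℝ) := by
    rw [div_le_iff₀ (by norm_num)]
    have : k ≤ (k / 2) * 4 := by omega
    exact_mod_cast this
  have h4 : (1 / 2 : ℝ) ≤ Real.log 2 := by linarith [Real.log_two_gt_d9]
  nlinarith

/-- The biases are bounded by `g = C * (k / 8) ^ (-(1 / 2 + δ))` from time `2 ^ (k / 2)` on, and
`k * g ^ 2` tends to zero. -/
theorem ae_simplyPoissonGeneric {γ : ℕ+ → ℝ}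
    (hγ : ∀ n, γ n ∈ Set.Ioo (-(1 / 2) : ℝ) (1 / 2)) {δ : ℝ} (hδ : 0 < δ)
    (hO : γ =O[atTop] fun n : ℕ+ => Real.log (n : ℝ) ^ (-(1 / 2 + δ))) :
    ∀ᵐ x ∂(nuMeasure γ), SimplyPoissonGeneric x := by
  obtain ⟨C, hC, hb⟩ := hO.exists_pos
  rw [IsBigOWith, eventually_atTop] at hb
  obtain ⟨N, hN⟩ := hb
  set g : ℕ → ℝ := fun k => C * ((k : ℝ) / 8) ^ (-(1 / 2 + δ)) with hg
  have hx : Tendsto (fun k : ℕ => (k : ℝ) / 8) atTop atTop :=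
    tendsto_natCast_atTop_atTop.atTop_div_const (by norm_num)
  have hg1 : Tendsto g atTop (nhds 0) := by
    have := ((tendsto_rpow_neg_atTop (show 0 < 1 / 2 + δ by linarith)).comp hx).const_mul C
    simpa [hg] using this
  have hg2 : Tendsto (fun k : ℕ => k * g k ^ 2) atTop (nhds 0) := by
    have h1 := ((tendsto_rpow_neg_atTop (show 0 < 2 * δ by linarith)).comp hx).const_mul (8 * C ^ 2)
    rw [mul_zero] at h1
    refine h1.congr' ?_
    filter_upwards [eventually_gt_atTop 0] with k hk
    have hk0 : 0 < (k : ℝ) / 8 := by positivity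
    have e1 : (((k : ℝ) / 8) ^ (-(1 / 2 + δ))) ^ 2 * ((k : ℝ) / 8) = ((k : ℝ) / 8) ^ (-(2 * δ)) := by
      rw [← Real.rpow_natCast, ← Real.rpow_mul hk0.le, ← Real.rpow_add_one hk0.ne']
      congr 1; push_cast; ring
    simp only [Function.comp, hg]
    rw [← e1]
    ring
  have hbd : ∀ᶠ k : ℕ in atTop, ∀ t, 2 ^ (k / 2) ≤ t → |γ (Nat.succPNat t)| ≤ g k := by
    have hlarge : Tendsto (fun k : ℕ => 2 ^ (k / 2)) atTop atTop :=
      (tendsto_pow_atTop_atTop_of_one_lt (by norm_num : 1 < 2)).comp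
        (Nat.tendsto_div_const_atTop (by norm_num))
    filter_upwards [eventually_ge_atTop 2, hlarge.eventually_ge_atTop (N : ℕ)] with k hk hkN t ht
    have h1 := hN (Nat.succPNat t) (by
      rw [← PNat.coe_le_coe, Nat.succPNat_coe]; omega)
    have hlog := div_eight_le_log hk (ht.trans (Nat.le_succ t))
    rw [Nat.succPNat_coe] at h1
    have hk0 : 0 < (k : ℝ) / 8 := by positivity
    refine h1.trans (mul_le_mul_of_nonneg_left ?_ hC.le)
    rw [Real.norm_of_nonneg (Real.rpow_nonneg (hk0.le.trans hlog) _)]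
    exact Real.rpow_le_rpow_of_nonpos hk0 hlog (by linarith)
  have hg0 : ∀ k, 0 ≤ g k := fun k => mul_nonneg hC.le (Real.rpow_nonneg (by positivity) _)
  have hs : ∀ m : ℕ, 0 ≤ 1 / ((m : ℝ) + 1) ∧ 1 / ((m : ℝ) + 1) ≤ 1 := fun m =>
    ⟨by positivity, by rw [div_le_one (by positivity)]; linarith [(Nat.cast_nonneg m : (0 : ℝ) ≤ m)]⟩
  filter_upwards [ae_all_iff.2 fun m : ℕ => ae_tendsto_genFun_sub_integral hγ (hs m).1 (hs m).2]
    with x hx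
  refine simplyPoissonGeneric_of_tendsto_genFun fun m => ?_
  have := (hx m).add (tendsto_integral_genFun hγ (hs m).1 (hs m).2 hg0 hg1 hg2 hbd)
  simpa using this

/-! ### Large biases: almost no word occurs -/

theorem one_add_le_exp_sub_sq {u : ℝ} (hu : |u| ≤ 1 / 4) : 1 + u ≤ Real.exp (u - u ^ 2 / 4) := by
  obtain ⟨h1, h2⟩ := abs_le.1 hu
  set y := u - u ^ 2 / 4 with hy
  have hfac : y = u * (1 - u / 4) := by rw [hy]; ring
  have hyabs : |y| ≤ |u| * (17 / 16) := by
    rw [hfac, abs_mul]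
    gcongr
    rw [abs_le]; constructor <;> linarith
  have hy1 : |y| ≤ 1 := by linarith
  have hb := Real.exp_bound hy1 (n := 3) (by norm_num)
  norm_num [Finset.sum_range_succ, Nat.factorial] at hb
  have hb1 := (abs_le.1 hb).1
  have hcube : |y| ^ 3 ≤ u ^ 2 * (1 / 3) := by
    calc |y| ^ 3 ≤ (|u| * (17 / 16)) ^ 3 := by gcongr
      _ = |u| ^ 2 * |u| * (17 / 16) ^ 3 := by ring
      _ ≤ |u| ^ 2 * (1 / 4) * (17 / 16) ^ 3 := by gcongr
      _ ≤ u ^ 2 * (1 / 3) := by rw [sq_abs]; nlinarith [sq_nonneg u]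
  have hsq : u ^ 2 * (4 / 5) ≤ y ^ 2 := by
    have : y ^ 2 = u ^ 2 * (1 - u / 4) ^ 2 := by rw [hfac]; ring
    rw [this]
    exact mul_le_mul_of_nonneg_left (by nlinarith) (sq_nonneg u)
  have : y + u ^ 2 / 4 = u := by rw [hy]; ring
  nlinarith [sq_nonneg u]

/-- The sum of the letters of a word. -/
noncomputable def signSum {k : ℕ} (w : Fin k → ℤˣ) : ℝ := ∑ i, ((w i : ℤ) : ℝ)

/-- Chernoff bound for the sum of the letters of a uniformly distributed word. -/
theorem card_signSum_gt_le {k : ℕ} (hk : 1 ≤ k) {R : ℝ} (hR : 0 ≤ R) :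
    (((Finset.univ.filter fun w : Fin k → ℤˣ => R < signSum w).card : ℕ) : ℝ)
      ≤ 2 ^ k * Real.exp (-(R ^ 2 / (2 * k))) := by
  have hk0 : (0 : ℝ) < k := by exact_mod_cast hk
  set θ := R / k with hθ
  have hθ0 : 0 ≤ θ := by positivity
  have hmgf : ∑ w : Fin k → ℤˣ, Real.exp (θ * signSum w) ≤ 2 ^ k * Real.exp (k * (θ ^ 2 / 2)) := by
    have e1 : ∀ w : Fin k → ℤˣ, Real.exp (θ * signSum w)
        = ∏ i, Real.exp (θ * ((w i : ℤ) : ℝ)) := fun w => by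
      rw [signSum, Finset.mul_sum, Real.exp_sum]
    simp only [e1]
    rw [sum_words_prod fun (_ : Fin k) u => Real.exp (θ * ((u : ℤ) : ℝ)), Finset.prod_const,
      Finset.card_univ, Fintype.card_fin, sum_units]
    have e2 : Real.exp (θ * (((1 : ℤˣ) : ℤ) : ℝ)) + Real.exp (θ * (((-1 : ℤˣ) : ℤ) : ℝ))
        = 2 * Real.cosh θ := by
      rw [Real.cosh_eq]; simp; ring
    rw [e2, mul_pow, Real.exp_nat_mul]
    gcongr
    exact Real.cosh_le_exp_half_sq θ
  have hmarkov : ((Finset.univ.filter fun w : Fin k → ℤˣ => R < signSum w).card : ℝ)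
      * Real.exp (θ * R) ≤ ∑ w : Fin k → ℤˣ, Real.exp (θ * signSum w) := by
    rw [← nsmul_eq_mul, ← Finset.sum_const]
    refine (Finset.sum_le_sum fun w hw => ?_).trans (Finset.sum_le_sum_of_subset_of_nonneg
      (Finset.filter_subset _ _) fun w _ _ => (Real.exp_pos _).le)
    rw [Finset.mem_filter] at hw
    exact Real.exp_le_exp.2 (mul_le_mul_of_nonneg_left hw.2.le hθ0)
  have h := hmarkov.trans hmgf
  rw [← le_div_iff₀ (Real.exp_pos _), mul_div_assoc, ← Real.exp_sub] at h
  refine h.trans (le_of_eq ?_)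
  congr 2
  rw [hθ]; field_simp; ring

/-- If the biases over a window are between `a` and `C * a` and vary by at most `η`, then a word
whose letters do not sum to more than `R` is much less likely to occur than under fair coins. -/
theorem nuMeasure_real_hit_le_of_signSum_le {γ : ℕ+ → ℝ}
    (hγ : ∀ n, γ n ∈ Set.Ioo (-(1 / 2) : ℝ) (1 / 2)) {k t : ℕ} {w : Fin k → ℤˣ} {a C η R : ℝ}
    (ha : 0 ≤ a) (hCa : C * a ≤ 1 / 8) (hR : 0 ≤ R) (hw : signSum w ≤ R) (h0 : 1 ≤ k)
    (hlo : ∀ i < k, a ≤ γ (Nat.succPNat (t + i)))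
    (hhi : ∀ i < k, γ (Nat.succPNat (t + i)) ≤ C * a)
    (hη : ∀ i < k, |γ (Nat.succPNat (t + i)) - γ (Nat.succPNat t)| ≤ η) :
    (nuMeasure γ).real (hit w t)
      ≤ Real.exp (2 * (C * a * R + k * η) - k * a ^ 2) / 2 ^ k := by
  rw [nuMeasure_real_hit hγ]
  set b := γ (Nat.succPNat t) with hb
  have hb0 : a ≤ b := hlo 0 (by omega)
  have hbC : b ≤ C * a := hhi 0 (by omega)
  have hfac : ∀ i : Fin k, signMass γ (t + i) (w i)
      ≤ Real.exp (2 * (b * ((w i : ℤ) : ℝ) + η) - a ^ 2) / 2 := by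
    intro i
    set c := γ (Nat.succPNat (t + i)) with hc
    have c1 : a ≤ c := hlo i i.2
    have c2 : c ≤ C * a := hhi i i.2
    have c3 := abs_le.1 (hη i i.2)
    have hcsq : a ^ 2 ≤ c ^ 2 := pow_le_pow_left₀ ha c1 2
    have hcabs : |c| ≤ 1 / 8 := by rw [abs_of_nonneg (ha.trans c1)]; linarith
    set e : ℝ := ((w i : ℤ) : ℝ) with he
    have he1 : e = 1 ∨ e = -1 := by
      rcases Int.units_eq_one_or (w i) with h | h <;> simp [he, h]
    have heabs : |e| = 1 := by rcases he1 with h | h <;> simp [h]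
    have hesq : e ^ 2 = 1 := by rcases he1 with h | h <;> simp [h]
    have hu : |2 * (e * c)| ≤ 1 / 4 := by
      rw [abs_mul, abs_mul, heabs, abs_two]; linarith
    have h1 := one_add_le_exp_sub_sq hu
    have h2 : signMass γ (t + i) (w i) = (1 + 2 * (e * c)) / 2 := by
      simp only [signMass, ← hc, ← he]; ring
    rw [h2]
    refine div_le_div_of_nonneg_right (h1.trans (Real.exp_le_exp.2 ?_)) (by norm_num)
    have h3 : (2 * (e * c)) ^ 2 / 4 = c ^ 2 := by
      have : (2 * (e * c)) ^ 2 / 4 = e ^ 2 * c ^ 2 := by ring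
      rw [this, hesq, one_mul]
    have h4 : e * c ≤ b * e + η := by
      rcases he1 with h | h <;> rw [h] <;> linarith
    rw [h3]
    linarith
  calc ∏ i : Fin k, signMass γ (t + i) (w i)
      ≤ ∏ i : Fin k, (Real.exp (2 * (b * ((w i : ℤ) : ℝ) + η) - a ^ 2) / 2) :=
        Finset.prod_le_prod (fun i _ => signMass_nonneg hγ _ _) fun i _ => hfac i
    _ = Real.exp (2 * (b * signSum w + k * η) - k * a ^ 2) / 2 ^ k := by
        rw [Finset.prod_div_distrib, ← Real.exp_sum, Finset.prod_const, Finset.card_univ,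
          Fintype.card_fin, signSum]
        congr 2
        rw [Finset.sum_sub_distrib, ← Finset.mul_sum, Finset.sum_add_distrib, ← Finset.mul_sum]
        simp
    _ ≤ _ := by
        have hbS : b * signSum w ≤ C * a * R :=
          (mul_le_mul_of_nonneg_left hw (ha.trans hb0)).trans (mul_le_mul_of_nonneg_right hbC hR)
        refine div_le_div_of_nonneg_right (Real.exp_le_exp.2 ?_) (by positivity)
        linarith

/-- The probability that a uniformly distributed word occurs at all is small: the threshold
`R = k * a / (4 * C)` for the sum of the letters balances the drift `2 * C * a * R` against the
entropy gain `k * a ^ 2`. -/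
theorem sum_nuMeasure_real_occurrences_ne_zero_le {γ : ℕ+ → ℝ}
    (hγ : ∀ n, γ n ∈ Set.Ioo (-(1 / 2) : ℝ) (1 / 2)) {k T : ℕ} {a C η : ℝ} (hk : 1 ≤ k)
    (ha : 0 ≤ a) (hC : 0 < C) (hCa : C * a ≤ 1 / 8)
    (hlo : ∀ t, T ≤ t → t < 2 ^ k + k → a ≤ γ (Nat.succPNat t))
    (hhi : ∀ t, T ≤ t → t < 2 ^ k + k → γ (Nat.succPNat t) ≤ C * a)
    (hη : ∀ t, T ≤ t → t < 2 ^ k → ∀ i < k, |γ (Nat.succPNat (t + i)) - γ (Nat.succPNat t)| ≤ η) :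
    (∑ w : Fin k → ℤˣ, (nuMeasure γ).real {x | occurrences x k w ≠ 0}) / 2 ^ k
      ≤ T / 2 ^ k + Real.exp (-(k * a ^ 2 / (32 * C ^ 2)))
        + Real.exp (2 * (k * η) - k * a ^ 2 / 2) := by
  have := isProbabilityMeasure_nuMeasure hγ
  classical
  have hk0 : (0 : ℝ) < k := by exact_mod_cast hk
  have h2 : (0 : ℝ) < 2 ^ k := by positivity
  set R := k * a / (4 * C) with hR
  have hR0 : 0 ≤ R := by positivity
  set M := Real.exp (2 * (k * η) - k * a ^ 2 / 2) with hM
  have hM0 : 0 ≤ M := (Real.exp_pos _).le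
  have hword : ∀ w : Fin k → ℤˣ, (nuMeasure γ).real {x | occurrences x k w ≠ 0}
      ≤ ∑ t ∈ Finset.range T, (nuMeasure γ).real (hit w t)
        + ((if R < signSum w then 1 else 0) + M) := by
    intro w
    have hsub : {x | occurrences x k w ≠ 0}
        ⊆ (⋃ t ∈ Finset.range T, hit w t) ∪ ⋃ t ∈ Finset.Ico T (2 ^ k), hit w t := by
      intro x hx
      obtain ⟨t, ht⟩ := Finset.card_ne_zero.1 (show occurrences x k w ≠ 0 from hx)
      rw [Finset.mem_filter, Finset.mem_range] at ht
      rcases lt_or_ge t T with h | h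
      · exact Or.inl (Set.mem_biUnion (Finset.mem_coe.2 (Finset.mem_range.2 h)) ht.2)
      · exact Or.inr (Set.mem_biUnion (Finset.mem_coe.2 (Finset.mem_Ico.2 ⟨h, ht.1⟩)) ht.2)
    refine (measureReal_mono hsub (measure_ne_top _ _)).trans ((measureReal_union_le _ _).trans
      (add_le_add (measureReal_biUnion_finset_le _ _) ?_))
    by_cases hw : R < signSum w
    · rw [if_pos hw]
      linarith [measureReal_le_one (μ := nuMeasure γ) (s := ⋃ t ∈ Finset.Ico T (2 ^ k), hit w t)]
    · rw [if_neg hw, zero_add]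
      refine (measureReal_biUnion_finset_le _ _).trans ?_
      calc ∑ t ∈ Finset.Ico T (2 ^ k), (nuMeasure γ).real (hit w t)
          ≤ ∑ t ∈ Finset.Ico T (2 ^ k), M / 2 ^ k := by
            refine Finset.sum_le_sum fun t ht => ?_
            rw [Finset.mem_Ico] at ht
            refine (nuMeasure_real_hit_le_of_signSum_le hγ ha hCa hR0 (not_lt.1 hw) hk
              (fun i hi => hlo _ (by omega) (by omega)) (fun i hi => hhi _ (by omega) (by omega))
              (hη t ht.1 ht.2)).trans (le_of_eq ?_)
            rw [hM, hR]
            congr 2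
            field_simp
            ring
        _ = ((2 ^ k - T : ℕ) : ℝ) * (M / 2 ^ k) := by simp
        _ ≤ 2 ^ k * (M / 2 ^ k) := by
            refine mul_le_mul_of_nonneg_right ?_ (by positivity)
            exact_mod_cast Nat.sub_le _ _
        _ = M := by field_simp
  have hbad : ∑ w : Fin k → ℤˣ, (if R < signSum w then (1 : ℝ) else 0)
      ≤ 2 ^ k * Real.exp (-(k * a ^ 2 / (32 * C ^ 2))) := by
    rw [Finset.sum_boole]
    refine (card_signSum_gt_le hk hR0).trans (le_of_eq ?_)
    congr 3
    rw [hR]; field_simp; ring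
  rw [div_le_iff₀ h2]
  calc ∑ w : Fin k → ℤˣ, (nuMeasure γ).real {x | occurrences x k w ≠ 0}
      ≤ ∑ w : Fin k → ℤˣ, (∑ t ∈ Finset.range T, (nuMeasure γ).real (hit w t)
        + ((if R < signSum w then 1 else 0) + M)) := Finset.sum_le_sum fun w _ => hword w
    _ = T + (∑ w : Fin k → ℤˣ, (if R < signSum w then (1 : ℝ) else 0) + 2 ^ k * M) := by
        rw [Finset.sum_add_distrib, Finset.sum_add_distrib, Finset.sum_comm]
        simp [sum_nuMeasure_real_hit hγ]
    _ ≤ T + (2 ^ k * Real.exp (-(k * a ^ 2 / (32 * C ^ 2))) + 2 ^ k * M) := by gcongr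
    _ = _ := by field_simp; ring

/-- If the probability that a random word occurs at all tends to zero in mean, then it tends to zero
almost surely along a subsequence, which excludes a Poisson limit. -/
theorem ae_not_simplyPoissonGeneric_of_tendsto {γ : ℕ+ → ℝ}
    (hγ : ∀ n, γ n ∈ Set.Ioo (-(1 / 2) : ℝ) (1 / 2))
    (h : Tendsto (fun k : ℕ => (∑ w : Fin k → ℤˣ,
      (nuMeasure γ).real {x | occurrences x k w ≠ 0}) / 2 ^ k) atTop (nhds 0)) :
    ∀ᵐ x ∂(nuMeasure γ), ¬ SimplyPoissonGeneric x := by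
  have := isProbabilityMeasure_nuMeasure hγ
  classical
  have hms : ∀ k (w : Fin k → ℤˣ), MeasurableSet {x | occurrences x k w ≠ 0} := fun k w =>
    measurable_occurrences k w (MeasurableSet.of_discrete (s := {n : ℕ | n ≠ 0}))
  set f : ℕ → (ℕ+ → ℤˣ) → ℝ := fun k x =>
    (∑ w : Fin k → ℤˣ, {x | occurrences x k w ≠ 0}.indicator (fun _ => (1 : ℝ)) x) / 2 ^ k with hf
  have hf0 : ∀ k x, 0 ≤ f k x := fun k x =>
    div_nonneg (Finset.sum_nonneg fun w _ => Set.indicator_nonneg (fun _ _ => zero_le_one) _)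
      (by positivity)
  have hind : ∀ k (w : Fin k → ℤˣ), Integrable
      ({x | occurrences x k w ≠ 0}.indicator (fun _ => (1 : ℝ))) (nuMeasure γ) :=
    fun k w => (integrable_const 1).indicator (hms k w)
  have hfi : ∀ k, Integrable (f k) (nuMeasure γ) := fun k =>
    (integrable_finsetSum _ fun w _ => hind k w).div_const _
  have hint : ∀ k, ∫ x, f k x ∂nuMeasure γ = (∑ w : Fin k → ℤˣ,
      (nuMeasure γ).real {x | occurrences x k w ≠ 0}) / 2 ^ k := by
    intro k
    simp only [hf]
    rw [integral_div, integral_finsetSum _ fun w _ => hind k w]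
    congr 1
    refine Finset.sum_congr rfl fun w _ => ?_
    rw [integral_indicator_const _ (hms k w)]; simp
  have hmeas : TendstoInMeasure (nuMeasure γ) f atTop (fun _ => (0 : ℝ)) := by
    refine tendstoInMeasure_of_tendsto_eLpNorm one_ne_zero (fun k => (hfi k).aestronglyMeasurable)
      aestronglyMeasurable_const ?_
    have e : ∀ k, eLpNorm (f k - fun _ => (0 : ℝ)) 1 (nuMeasure γ)
        = ENNReal.ofReal (∫ x, f k x ∂nuMeasure γ) := by
      intro k
      have e0 : (f k - fun _ => (0 : ℝ)) = f k := by ext x; simp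
      rw [e0, eLpNorm_one_eq_lintegral_enorm, ofReal_integral_eq_lintegral_ofReal (hfi k)
        (.of_forall (hf0 k))]
      exact lintegral_congr fun x => Real.enorm_of_nonneg (hf0 k x)
    simp only [e, hint]
    simpa using ENNReal.tendsto_ofReal h
  obtain ⟨ns, hns, hae⟩ := hmeas.exists_seq_tendsto_ae
  filter_upwards [hae] with x hx hgen
  have h1 := (hgen 0).comp hns.tendsto_atTop
  have h2 : ∀ k, (uniformOn (Set.univ : Set (Fin k → ℤˣ))).real {w | occurrences x k w = 0}
      = 1 - f k x := by
    intro k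
    have e1 : ∀ w : Fin k → ℤˣ, (if 0 = occurrences x k w then (1 : ℝ) else 0)
        = 1 - {x | occurrences x k w ≠ 0}.indicator (fun _ => (1 : ℝ)) x := by
      intro w
      by_cases hw : occurrences x k w = 0
      · simp [hw]
      · simp [hw, Ne.symm hw]
    rw [uniformOn_real_occurrences]
    simp only [e1, hf]
    rw [Finset.sum_sub_distrib, sub_div]
    congr 1
    simp
  have h3 : Tendsto (fun i => 1 - f (ns i) x) atTop (nhds (Real.exp (-1) / (0 ! : ℕ))) :=
    h1.congr fun i => h2 (ns i)
  have h4 := tendsto_nhds_unique h3 (hx.const_sub 1)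
  -- The limit of the probability of the value `0` would be `exp (-1)` and `1` at once.
  simp at h4

theorem rpow_neg_sub_rpow_neg_le {β s t : ℝ} (h0 : 0 ≤ β) (h1 : β ≤ 1) (hs : 1 ≤ s) (hst : s ≤ t) :
    |t ^ (-β) - s ^ (-β)| ≤ t - s := by
  have hs0 : 0 < s := by linarith
  have ht0 : 0 < t := by linarith
  have a1 : t ^ (-β) ≤ s ^ (-β) := Real.rpow_le_rpow_of_nonpos hs0 hst (by linarith)
  have a2 : s ^ (-β) ≤ 1 := Real.rpow_le_one_of_one_le_of_nonpos hs (by linarith)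
  have a3 : t ^ (-β) = s ^ (-β) * (s / t) ^ β := by
    rw [Real.div_rpow hs0.le ht0.le, Real.rpow_neg hs0.le, Real.rpow_neg ht0.le]
    have := (Real.rpow_pos_of_pos hs0 β).ne'
    field_simp
  have a4 : s / t ≤ (s / t) ^ β := by
    have hle : s / t ≤ 1 := (div_le_one ht0).2 hst
    simpa using Real.rpow_le_rpow_of_exponent_ge (by positivity) hle h1
  have a5 : 1 - s / t ≤ t - s := by
    have : 1 - s / t = (t - s) / t := by field_simp
    rw [this, div_le_iff₀ ht0]
    nlinarith
  have a6 : 0 < s ^ (-β) := Real.rpow_pos_of_pos hs0 _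
  rw [abs_of_nonpos (by linarith), a3]
  have a7 : s / t ≤ 1 := (div_le_one ht0).2 hst
  nlinarith

theorem tendsto_sq_div_two_pow_half :
    Tendsto (fun k : ℕ => (k : ℝ) * (k / 2 ^ (k / 2))) atTop (nhds 0) := by
  have h1 := ((tendsto_pow_const_mul_const_pow_of_abs_lt_one 2 (r := (1 / 2 : ℝ))
    (by rw [abs_of_pos] <;> norm_num)).const_mul 9).comp
    (Nat.tendsto_div_const_atTop (show 2 ≠ 0 by norm_num))
  rw [mul_zero] at h1
  refine squeeze_zero' (.of_forall fun k => by positivity) ?_ h1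
  filter_upwards [eventually_ge_atTop 2] with k hk
  have h2 : (k : ℝ) ≤ 3 * ((k / 2 : ℕ) : ℝ) := by
    have : k ≤ 3 * (k / 2) := by omega
    exact_mod_cast this
  simp only [Function.comp]
  rw [one_div, inv_pow]
  calc (k : ℝ) * (k / 2 ^ (k / 2))
      ≤ (3 * ((k / 2 : ℕ) : ℝ)) * ((3 * ((k / 2 : ℕ) : ℝ)) / 2 ^ (k / 2)) := by gcongr
    _ = _ := by field_simp; ring

/-- The biases `(log n) ^ (-β)` with `β < 1 / 2` are of the order of `a = (k + 1) ^ (-β)` at the times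
between `2 ^ (k / 2)` and `2 ^ k`, and `k * a ^ 2` tends to infinity. -/
theorem ae_not_simplyPoissonGeneric {γ : ℕ+ → ℝ}
    (hγ : ∀ n, γ n ∈ Set.Ioo (-(1 / 2) : ℝ) (1 / 2)) {δ : ℝ} (hδ : 0 < δ)
    (hev : ∀ᶠ n : ℕ+ in atTop, γ n = Real.log (n : ℝ) ^ (-(1 / 2 - δ))) :
    ∀ᵐ x ∂(nuMeasure γ), ¬ SimplyPoissonGeneric x := by
  obtain ⟨N, hN⟩ := eventually_atTop.1 hev
  have hN' : ∀ t : ℕ, (N : ℕ) ≤ t → γ (Nat.succPNat t)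
      = Real.log ((t + 1 : ℕ) : ℝ) ^ (-(1 / 2 - δ)) := by
    intro t ht
    have := hN (Nat.succPNat t) (by rw [← PNat.coe_le_coe, Nat.succPNat_coe]; omega)
    rwa [Nat.succPNat_coe] at this
  have hlarge : Tendsto (fun k : ℕ => 2 ^ (k / 2)) atTop atTop :=
    (tendsto_pow_atTop_atTop_of_one_lt (by norm_num : 1 < 2)).comp
      (Nat.tendsto_div_const_atTop (by norm_num))
  set β := 1 / 2 - δ with hβ
  -- A nonpositive exponent would make the biases at least one.
  have hβ0 : 0 < β := by
    by_contra hneg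
    obtain ⟨k, hk8, hkN⟩ := ((eventually_ge_atTop 8).and
      (hlarge.eventually_ge_atTop (N : ℕ))).exists
    have h1 := hN' (2 ^ (k / 2)) hkN
    have h2 := div_eight_le_log (by omega) (Nat.le_succ (2 ^ (k / 2)))
    have h3 : (1 : ℝ) ≤ (k : ℝ) / 8 := by
      rw [le_div_iff₀ (by norm_num)]
      have : 1 * 8 ≤ k := by omega
      exact_mod_cast this
    have h4 := Real.one_le_rpow (h3.trans h2) (show 0 ≤ -β by linarith)
    have h5 := (hγ (Nat.succPNat (2 ^ (k / 2)))).2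
    rw [h1] at h5
    simp only [Nat.succ_eq_add_one] at h4
    linarith
  have hβ1 : β ≤ 1 / 2 := by linarith
  set a : ℕ → ℝ := fun k => ((k : ℝ) + 1) ^ (-β) with ha
  have hx : Tendsto (fun k : ℕ => (k : ℝ) + 1) atTop atTop :=
    tendsto_atTop_add_const_right _ _ tendsto_natCast_atTop_atTop
  have ha0 : Tendsto a atTop (nhds 0) := (tendsto_rpow_neg_atTop hβ0).comp hx
  have hka : Tendsto (fun k : ℕ => k * a k ^ 2) atTop atTop := by
    have h1 := ((tendsto_rpow_atTop (show 0 < 2 * δ by linarith)).comp hx).atTop_div_const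
      (show (0 : ℝ) < 2 by norm_num)
    refine tendsto_atTop_mono' _ ?_ h1
    filter_upwards [eventually_ge_atTop 1] with k hk
    have hk1 : (1 : ℝ) ≤ k := by exact_mod_cast hk
    have hk0 : (0 : ℝ) < (k : ℝ) + 1 := by positivity
    have e1 : (((k : ℝ) + 1) ^ (-β)) ^ 2 * ((k : ℝ) + 1) = ((k : ℝ) + 1) ^ (2 * δ) := by
      rw [← Real.rpow_natCast, ← Real.rpow_mul hk0.le, ← Real.rpow_add_one hk0.ne']
      congr 1; push_cast; rw [hβ]; ring
    simp only [Function.comp, ha]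
    rw [← e1]
    have := sq_nonneg (((k : ℝ) + 1) ^ (-β))
    nlinarith
  refine ae_not_simplyPoissonGeneric_of_tendsto hγ ?_
  have hlim : Tendsto (fun k : ℕ => (2 : ℝ) ^ (k / 2) / 2 ^ k
      + Real.exp (-(k * a k ^ 2 / (32 * 16 ^ 2)))
      + Real.exp (2 * (k * (k / 2 ^ (k / 2))) - k * a k ^ 2 / 2)) atTop (nhds 0) := by
    have l1 : Tendsto (fun k : ℕ => Real.exp (-(k * a k ^ 2 / (32 * 16 ^ 2)))) atTop (nhds 0) :=
      Real.tendsto_exp_neg_atTop_nhds_zero.comp (hka.atTop_div_const (by norm_num))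
    have l2 : Tendsto (fun k : ℕ => 2 * ((k : ℝ) * (k / 2 ^ (k / 2))) - k * a k ^ 2 / 2) atTop
        atBot := by
      simp only [sub_eq_add_neg]
      exact (tendsto_sq_div_two_pow_half.const_mul 2).add_atBot
        (tendsto_neg_atTop_atBot.comp (hka.atTop_div_const (by norm_num)))
    have := (tendsto_two_pow_half_div_two_pow.add l1).add (Real.tendsto_exp_atBot.comp l2)
    simpa using this
  refine squeeze_zero' (.of_forall fun k => div_nonneg
    (Finset.sum_nonneg fun _ _ => measureReal_nonneg) (by positivity)) ?_ hlim
  filter_upwards [eventually_ge_atTop 8, hlarge.eventually_ge_atTop (N : ℕ),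
    ha0.eventually (gt_mem_nhds (show (0 : ℝ) < 1 / 128 by norm_num))] with k hk hkN hak
  have hk8 : (8 : ℝ) ≤ k := by exact_mod_cast hk
  have hapos : 0 ≤ a k := Real.rpow_nonneg (by positivity) _
  have hloglo : ∀ t, 2 ^ (k / 2) ≤ t → (k : ℝ) / 8 ≤ Real.log ((t + 1 : ℕ) : ℝ) := fun t ht =>
    div_eight_le_log (by omega) (by omega)
  have hmain := sum_nuMeasure_real_occurrences_ne_zero_le hγ (k := k) (T := 2 ^ (k / 2)) (a := a k)
    (C := 16) (η := k / 2 ^ (k / 2)) (by omega) hapos (by norm_num) (by linarith) ?_ ?_ ?_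
  · push_cast at hmain
    exact hmain
  · intro t ht htk
    rw [hN' t (by omega)]
    have hl := hloglo t ht
    refine Real.rpow_le_rpow_of_nonpos (by linarith) ?_ (by linarith)
    have hle : ((t + 1 : ℕ) : ℝ) ≤ 2 ^ (k + 1) := by
      have h1 : k < 2 ^ k := Nat.lt_two_pow_self
      have : t + 1 ≤ 2 ^ (k + 1) := by rw [pow_succ]; omega
      exact_mod_cast this
    have := Real.log_le_log (by positivity) hle
    rw [Real.log_pow] at this
    push_cast at this ⊢
    nlinarith [Real.log_two_lt_d9]
  · intro t ht htk
    rw [hN' t (by omega)]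
    have h16 : ((k : ℝ) + 1) / 16 ≤ Real.log ((t + 1 : ℕ) : ℝ) := by linarith [hloglo t ht]
    have hk1 : (0 : ℝ) ≤ (k : ℝ) + 1 := by positivity
    refine (Real.rpow_le_rpow_of_nonpos (by positivity) h16 (by linarith)).trans ?_
    rw [Real.div_rpow hk1 (by norm_num), Real.rpow_neg (by norm_num : (0 : ℝ) ≤ 16), div_inv_eq_mul,
      mul_comm]
    refine mul_le_mul_of_nonneg_right ?_ hapos
    simpa using Real.rpow_le_rpow_of_exponent_le (by norm_num : (1 : ℝ) ≤ 16)
      (show β ≤ 1 by linarith)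
  · intro t ht htk i hi
    rw [hN' t (by omega), hN' (t + i) (by omega)]
    have hl := hloglo t ht
    have ht0 : (0 : ℝ) < ((t + 1 : ℕ) : ℝ) := by positivity
    have hmono : Real.log ((t + 1 : ℕ) : ℝ) ≤ Real.log ((t + i + 1 : ℕ) : ℝ) :=
      Real.log_le_log ht0 (by push_cast; linarith [(Nat.cast_nonneg i : (0 : ℝ) ≤ i)])
    refine (rpow_neg_sub_rpow_neg_le hβ0.le (by linarith) (by linarith) hmono).trans ?_
    rw [← Real.log_div (by positivity) (by positivity)]
    refine (Real.log_le_sub_one_of_pos (by positivity)).trans ?_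
    have e1 : ((t + i + 1 : ℕ) : ℝ) / ((t + 1 : ℕ) : ℝ) - 1 = i / ((t + 1 : ℕ) : ℝ) := by
      field_simp; push_cast; ring
    rw [e1]
    have hik : (i : ℝ) ≤ k := by exact_mod_cast hi.le
    have hpt : (2 : ℝ) ^ (k / 2) ≤ ((t + 1 : ℕ) : ℝ) := by
      have : 2 ^ (k / 2) ≤ t + 1 := by omega
      exact_mod_cast this
    gcongr

theorem theorem1 (γ : ℕ+ → ℝ) (hγ : ∀ n, γ n ∈ Set.Ioo (-(1 / 2) : ℝ) (1 / 2)) :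
    ((∃ δ : ℝ, 0 < δ ∧
        γ =O[atTop] fun n : ℕ+ => Real.log (n : ℝ) ^ (-(1 / 2 + δ))) →
      ∀ᵐ x ∂(nuMeasure γ), SimplyPoissonGeneric x) ∧
    ((∃ δ : ℝ, 0 < δ ∧
        ∀ᶠ n : ℕ+ in atTop, γ n = Real.log (n : ℝ) ^ (-(1 / 2 - δ))) →
      ∀ᵐ x ∂(nuMeasure γ), ¬ SimplyPoissonGeneric x) := by
  refine ⟨?_, ?_⟩
  · rintro ⟨δ, hδ, hO⟩
    exact ae_simplyPoissonGeneric hγ hδ hO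
  · rintro ⟨δ, hδ, hev⟩
    exact ae_not_simplyPoissonGeneric hγ hδ hev
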